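/- Let $n\ge 2$, $\alpha>0$, $\beta\ge 0$. For $\gamma>0$ consider the Cauchy problem for the linearized compressible Navier–Stokes system in $\mathbb{R}^n$ $$\rho_t+\gamma\,\mathrm{div}\,v=0,\qquad v_t-\alpha\Delta v-\beta\nabla\mathrm{div}\,v+\gamma\nabla\rho=0\quad\text{in }(0,\infty)\times\mathbb{R}^n,\qquad \rho(0,\cdot)=\rho_0,\quad v(0,\cdot)=v_0,$$ with real-valued data $\rho_0\in L^2(\mathbb{R}^n)\cap L^{1,1}(\mathbb{R}^n)$ and $v_0=(v_{01},\dots,v_{0n})\in (L^2(\mathbb{R}^n)\cap L^{1,1}(\mathbb{R}^n))^n$, where $f\in L^{1,1}(\mathbb{R}^n)$ means $f \in L^1(\mathbb{R}^n)$ and $\|f\|_{1,1}:=\int_{\mathbb{R}^n}(1+|x|)|f(x)|\,dx<\infty$. Write $\|\cdot\|$ for the $L^2$-norm (with $\|f\|^2=\sum_j\|f_j\|^2$ for vector fields) and $$P_0:=\int_{\mathbb{R}^n}v_0(x)\,dx\in\mathbb{R}^n,\qquad Q_0:=\int_{\mathbb{R}^n}\rho_0(x)\,dx\in\mathbb{R}.$$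 A solution is a pair $(\rho,v)\in C([0,\infty);L^2(\mathbb{R}^n))\times C([0,\infty);L^2(\mathbb{R}^n)^n)$ that takes the initial data and satisfies the equations in the sense of tempered distributions in $x$ for every $t>0$ (that is, the pairings of $\rho(t)$ and $v_j(t)$ with each Schwartz function are differentiable in $t>0$, with the derivatives prescribed by the equations). There are constants $C_1>0$ and $K>0$ depending only on $n,\alpha,\beta$ and, for every $\gamma>0$, constants $C_2>0$ and $T_2>0$ depending only on $n,\alpha,\beta,\gamma$, such that for all such data and every solution $(\rho,v)$ the following holds. 1. For all $t\ge T_2$, $$\|v(t,\cdot)\|\le C_2\Big(|P_0|+|Q_0|+\sum_{j=1}^n\|v_{0j}\|_{1,1}+\|\rho_0\|_{1,1}+\|v_0\|+\|\rho_0\|\Big)t^{-n/4}.$$ 2. If $Q_0\neq 0$ and $|P_0|/|Q_0|<\frac{1}{1+K}$, then there is $T_1>0$ such that for all $t\ge T_1$ $$C_1\big(|P_0|+|Q_0|\big)t^{-n/4}\le\|v(t,\cdot)\|.$$ In particular, under the assumptions of part 2 the decay rate $t^{-n/4}$ is optimal. -/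

import Mathlib

open MeasureTheory

noncomputable section

namespace LinearizedNS

/-- `ℝⁿ` with its Euclidean norm. -/
abbrev E (n : ℕ) : Type := EuclideanSpace ℝ (Fin n)

/-- The partial derivative `∂φ/∂x_j`. -/
def pd {n : ℕ} (j : Fin n) (φ : E n → ℝ) (x : E n) : ℝ :=
  fderiv ℝ φ x (EuclideanSpace.single j 1)

/-- The Laplacian `∑ₖ ∂²φ/∂x_k²`. -/
def lap {n : ℕ} (φ : E n → ℝ) (x : E n) : ℝ :=
  ∑ k : Fin n, pd k (pd k φ) x

/-- Membership in the weighted space `L^{1,1}(ℝⁿ)`. -/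
def MemL11 {n : ℕ} (f : E n → ℝ) : Prop :=
  Integrable f ∧ Integrable (fun x => (1 + ‖x‖) * |f x|)

/-- The norm `‖f‖_{1,1} = ∫ (1 + |x|) |f(x)| dx`. -/
def norm11 {n : ℕ} (f : E n → ℝ) : ℝ :=
  ∫ x, (1 + ‖x‖) * |f x|

/-- The vector with the components `∫ f_j(x) dx`. -/
def moment {n : ℕ} (f : E n → E n) : E n :=
  WithLp.toLp 2 (fun j => ∫ x, f x j)

/-- `(ρ, v) ∈ C([0,∞); L²(ℝⁿ))^{1+n}` solves the Cauchy problem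
`ρ_t + γ div v = 0`, `v_t - α Δ v - β ∇ div v + γ ∇ ρ = 0`, `ρ(0) = ρ₀`, `v(0) = v₀`,
where the derivatives in `x` are taken in the sense of tempered distributions: every pairing with
a Schwartz function is differentiable in `t > 0`, and its derivative is given by the equations
with all derivatives in `x` moved to the test function. Values at `t < 0` are irrelevant. -/
structure IsSolution {n : ℕ} (α β γ : ℝ) (ρ₀ : Lp ℝ 2 (volume : Measure (E n)))
    (v₀ : Lp (E n) 2 (volume : Measure (E n)))
    (ρ : ℝ → Lp ℝ 2 (volume : Measure (E n)))
    (v : ℝ → Lp (E n) 2 (volume : Measure (E n))) : Prop where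
  continuousOn_density : ContinuousOn ρ (Set.Ici 0)
  continuousOn_velocity : ContinuousOn v (Set.Ici 0)
  initial_density : ρ 0 = ρ₀
  initial_velocity : v 0 = v₀
  mass : ∀ (φ : SchwartzMap (E n) ℝ) (t : ℝ), 0 < t →
    HasDerivAt (fun s => ∫ x, ρ s x * φ x)
      (∫ x, γ * ∑ k, v t x k * pd k φ x) t
  momentum : ∀ (j : Fin n) (φ : SchwartzMap (E n) ℝ) (t : ℝ), 0 < t →
    HasDerivAt (fun s => ∫ x, v s x j * φ x)
      (∫ x, (α * (v t x j * lap φ x) + β * ∑ k, v t x k * pd k (pd j φ) x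
        + γ * (ρ t x * pd j φ x))) t

end LinearizedNS

end

/-!
The Fourier transform in `x` turns the system into one linear ordinary differential equation for
each frequency `ξ`. A solution in the sense of distributions follows this flow at almost every
frequency: it suffices to test against smooth compactly supported functions of `ξ`, on whose
supports the symbol is bounded.

Upper bound: the viscosity damps the velocity only, but after adding to the energy of a mode a
small multiple of the cross term `Im (conj ρ̂ · ξ·v̂)`, the density is damped as well and the energy
decays like `exp (-κ t |ξ|² / (1 + |ξ|²))`. Since `ρ̂₀` and `v̂₀` are bounded, the low frequencies
contribute `t ^ (-n/2)` to the squared norm, and the high frequencies decay exponentially.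

Lower bound: on the annulus `|ξ| ~ t ^ (-1/2)` the longitudinal component `ξ·v̂/|ξ|` is, up to small
errors and a damping factor bounded below, `cos (2πγ|ξ|t) P₀·ξ/|ξ| - i sin (2πγ|ξ|t) Q₀`. As `P₀`
and `Q₀` are real, the first term does not affect the imaginary part, and the average of `sin²` over
the annulus is bounded below.
-/

open Filter Set SchwartzMap
open scoped ContDiff Topology Matrix FourierTransform SchwartzMap LineDeriv Real ComplexConjugate

noncomputable section

namespace LinearizedNS

section SquareIntegrable

variable {V F : Type*} [MeasurableSpace V] {μ : Measure V} [NormedAddCommGroup F]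

theorem integral_norm_sq_eq (f : Lp F 2 μ) : ∫ x, ‖f x‖ ^ 2 ∂μ = ‖f‖ ^ 2 := by
  have h0 : 0 ≤ ∫ x, ‖f x‖ ^ 2 ∂μ := integral_nonneg fun _ => sq_nonneg _
  rw [Lp.norm_def, (Lp.memLp f).eLpNorm_eq_integral_rpow_norm two_ne_zero ENNReal.ofNat_ne_top,
    ENNReal.toReal_ofReal (by positivity)]
  simp only [ENNReal.toReal_ofNat, Real.rpow_ofNat]
  rw [← Real.rpow_mul_natCast h0, Nat.cast_ofNat, inv_mul_cancel₀ two_ne_zero, Real.rpow_one]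

theorem integrable_norm_sq (f : Lp F 2 μ) : Integrable (fun x => ‖f x‖ ^ 2) μ :=
  (Lp.memLp f).integrable_norm_pow two_ne_zero

theorem setIntegral_norm_le (f : Lp F 2 μ) {s : Set V} (hs : μ s ≠ ⊤) :
    ∫ x in s, ‖f x‖ ∂μ ≤ μ.real s + ‖f‖ ^ 2 := by
  have : IsFiniteMeasure (μ.restrict s) := isFiniteMeasure_restrict.2 hs
  have hf : Integrable f (μ.restrict s) := (Lp.memLp f).restrict s |>.integrable one_le_two
  have hsq := (integrable_norm_sq f).integrableOn (s := s)
  calc ∫ x in s, ‖f x‖ ∂μ ≤ ∫ x in s, (1 + ‖f x‖ ^ 2) ∂μ := by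
        refine integral_mono hf.norm ((integrable_const 1).add hsq) fun x => ?_
        linarith [sq_nonneg (‖f x‖ - 1), sq_nonneg ‖f x‖]
    _ = μ.real s + ∫ x in s, ‖f x‖ ^ 2 ∂μ := by
        rw [integral_add (integrable_const 1) hsq, setIntegral_const, smul_eq_mul, mul_one]
    _ ≤ μ.real s + ∫ x, ‖f x‖ ^ 2 ∂μ := by
        exact add_le_add_right
          (setIntegral_le_integral (integrable_norm_sq f) (.of_forall fun _ => sq_nonneg _)) _
    _ = μ.real s + ‖f‖ ^ 2 := by rw [integral_norm_sq_eq]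

theorem continuous_integral_mul {𝕜 : Type*} [RCLike 𝕜] {g : V → 𝕜} (hg : MemLp g 2 μ) :
    Continuous fun f : Lp 𝕜 2 μ => ∫ x, g x * f x ∂μ := by
  have h : (fun f : Lp 𝕜 2 μ => ∫ x, g x * f x ∂μ) =
      fun f => inner 𝕜 (hg.star.toLp (star g)) f := by
    ext f
    rw [L2.inner_def]
    refine integral_congr_ae ?_
    filter_upwards [hg.star.coeFn_toLp] with x hx
    simp only [hx, RCLike.inner_apply, Pi.star_apply, RCLike.star_def, RCLike.conj_conj]
    exact mul_comm _ _
  rw [h]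
  fun_prop

end SquareIntegrable

/-- The bound `image_norm_le_of_norm_deriv_right_le_deriv_boundary` asks for a derivative at the
left endpoint as well, so it is applied on `[ε, s]` with `ε → 0`. -/
theorem norm_le_of_norm_deriv_le {F : Type*} [NormedAddCommGroup F] [NormedSpace ℝ F]
    {f f' : ℝ → F} {B B' : ℝ → ℝ} {T : ℝ}
    (hf : ContinuousOn f (Ici 0)) (hf0 : f 0 = 0) (hB0 : 0 ≤ B 0)
    (hf' : ∀ s, 0 < s → HasDerivAt f (f' s) s) (hB' : ∀ s, HasDerivAt B (B' s) s)
    (hle : ∀ s ∈ Icc 0 T, ‖f' s‖ ≤ B' s) {s : ℝ} (hs : s ∈ Icc 0 T) : ‖f s‖ ≤ B s := by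
  rcases hs.1.eq_or_lt with rfl | hs0
  · rwa [hf0, norm_zero]
  have hε : ∀ ε ∈ Ioo 0 s, ‖f s‖ ≤ ‖f ε‖ + (B s - B ε) := fun ε hε =>
    image_norm_le_of_norm_deriv_right_le_deriv_boundary (a := ε) (b := s) (f' := f')
      (B := fun x => ‖f ε‖ + (B x - B ε)) (B' := B')
      (hf.mono fun x hx => hε.1.le.trans hx.1)
      (fun x hx => (hf' x (hε.1.trans_le hx.1)).hasDerivWithinAt) (by simp)
      (fun x => ((hB' x).sub_const _).const_add _)
      (fun x hx => hle x ⟨hε.1.le.trans hx.1, hx.2.le.trans hs.2⟩) ⟨hε.2.le, le_rfl⟩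
  have hlim : Tendsto (fun ε => ‖f ε‖ + (B s - B ε)) (𝓝[>] 0) (𝓝 (‖f 0‖ + (B s - B 0))) :=
    ((hf 0 self_mem_Ici).mono Ioi_subset_Ici_self).norm.add
      (tendsto_const_nhds.sub ((hB' 0).continuousAt.tendsto.mono_left nhdsWithin_le_nhds))
  have hle0 := ge_of_tendsto hlim (by filter_upwards [Ioo_mem_nhdsGT hs0] with ε h using hε ε h)
  rw [hf0, norm_zero] at hle0
  linarith

theorem norm_dotProduct_le {ι R : Type*} [Fintype ι] [SeminormedRing R] (v w : ι → R) :
    ‖v ⬝ᵥ w‖ ≤ Fintype.card ι * (‖v‖ * ‖w‖) := by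
  calc ‖v ⬝ᵥ w‖ ≤ ∑ i, ‖v i * w i‖ := norm_sum_le _ _
    _ ≤ ∑ _i : ι, ‖v‖ * ‖w‖ := Finset.sum_le_sum fun i _ => (norm_mul_le _ _).trans <|
        mul_le_mul (norm_le_pi_norm v i) (norm_le_pi_norm w i) (norm_nonneg _) (norm_nonneg _)
    _ = Fintype.card ι * (‖v‖ * ‖w‖) := by
        rw [Finset.sum_const, Finset.card_univ, nsmul_eq_mul]

open scoped Matrix.Norms.Operator in
theorem exists_norm_vecMul_le {V ι 𝕜 : Type*} [NormedAddCommGroup V] [ProperSpace V] [Fintype ι]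
    [RCLike 𝕜] {A : V → Matrix ι ι 𝕜} (hA : Continuous A) (R : ℝ) :
    ∃ k, ∀ ξ ∈ Metric.closedBall (0 : V) R, ∀ u, ‖u ᵥ* A ξ‖ ≤ k * ‖u‖ := by
  obtain ⟨k, hk⟩ := (isCompact_closedBall (0 : V) R).exists_bound_of_continuousOn
    hA.matrix_transpose.continuousOn
  refine ⟨k, fun ξ hξ u => ?_⟩
  rw [← Matrix.mulVec_transpose]
  exact (Matrix.linfty_opNorm_mulVec _ _).trans
    (mul_le_mul_of_nonneg_right (hk ξ hξ) (norm_nonneg u))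

section WeakSolution

variable {V ι 𝕜 : Type*} [NormedAddCommGroup V] [NormedSpace ℝ V] [Fintype ι] [RCLike 𝕜]
  [MeasurableSpace V] {μ : Measure V} {A : V → Matrix ι ι 𝕜} {w w₁ w₂ : ℝ → V → ι → 𝕜}
  {φ : V → ι → 𝕜}

variable (μ A w) in
/-- `w` solves the family `∂ₜ w = A(ξ) w` of ordinary differential equations with parameter `ξ`,
for `t > 0`, after integration against smooth compactly supported functions of `ξ`. -/
structure IsWeakSolution : Prop where
  locallyIntegrable : ∀ t, 0 ≤ t → LocallyIntegrable (w t) μ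
  bounded : ∀ T R : ℝ, ∃ C, ∀ t ∈ Icc 0 T, ∫ ξ in Metric.closedBall 0 R, ‖w t ξ‖ ∂μ ≤ C
  continuousOn : ∀ φ : V → ι → 𝕜, ContDiff ℝ ∞ φ → HasCompactSupport φ →
    ContinuousOn (fun t => ∫ ξ, φ ξ ⬝ᵥ w t ξ ∂μ) (Ici 0)
  hasDerivAt : ∀ φ : V → ι → 𝕜, ContDiff ℝ ∞ φ → HasCompactSupport φ → ∀ t, 0 < t →
    HasDerivAt (fun s => ∫ ξ, φ ξ ⬝ᵥ w s ξ ∂μ) (∫ ξ, φ ξ ⬝ᵥ (A ξ *ᵥ w t ξ) ∂μ) t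

variable [FiniteDimensional ℝ V]

theorem norm_integral_dotProduct_le {f : V → ι → 𝕜} {R G : ℝ} (hf : LocallyIntegrable f μ)
    (hφ : tsupport φ ⊆ Metric.closedBall 0 R) (hG : ∀ ξ, ‖φ ξ‖ ≤ G) :
    ‖∫ ξ, φ ξ ⬝ᵥ f ξ ∂μ‖
      ≤ Fintype.card ι * (G * ∫ ξ in Metric.closedBall 0 R, ‖f ξ‖ ∂μ) := by
  have : ProperSpace V := FiniteDimensional.proper_real V
  have hi : IntegrableOn f (Metric.closedBall 0 R) μ :=
    hf.integrableOn_isCompact (isCompact_closedBall _ _)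
  rw [← setIntegral_eq_integral_of_forall_compl_eq_zero (s := Metric.closedBall 0 R) fun ξ hξ => by
    rw [image_eq_zero_of_notMem_tsupport (notMem_subset hφ hξ), zero_dotProduct],
    ← integral_const_mul, ← integral_const_mul]
  refine norm_integral_le_of_norm_le ((hi.norm.const_mul G).const_mul _) (.of_forall fun ξ => ?_)
  refine (norm_dotProduct_le _ _).trans ?_
  gcongr
  exact hG ξ

/-- Since the derivative of the pairing with `φ` is the pairing with `φ ᵥ* A`, the a priori bound
on `w` can be integrated any number of times. -/
theorem IsWeakSolution.norm_integral_le_pow_div_factorial (h : IsWeakSolution μ A w)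
    (hA : ∀ i l, ContDiff ℝ ∞ fun ξ => A ξ i l) (h0 : w 0 =ᵐ[μ] 0) {T R C k : ℝ}
    (hC : ∀ s ∈ Icc 0 T, ∫ ξ in Metric.closedBall 0 R, ‖w s ξ‖ ∂μ ≤ C)
    (hk : ∀ ξ ∈ Metric.closedBall (0 : V) R, ∀ u, ‖u ᵥ* A ξ‖ ≤ k * ‖u‖) (hk0 : 0 ≤ k) (N : ℕ)
    (hφ : ContDiff ℝ ∞ φ) (hφR : tsupport φ ⊆ Metric.closedBall 0 R) {G : ℝ}
    (hG : ∀ ξ, ‖φ ξ‖ ≤ G) {s : ℝ} (hs : s ∈ Icc 0 T) :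
    ‖∫ ξ, φ ξ ⬝ᵥ w s ξ ∂μ‖ ≤ Fintype.card ι * (G * C) * (k ^ N * (s ^ N / N.factorial)) := by
  have : ProperSpace V := FiniteDimensional.proper_real V
  have hG0 : 0 ≤ G := (norm_nonneg _).trans (hG 0)
  induction N generalizing φ G s with
  | zero =>
    refine (norm_integral_dotProduct_le (h.locallyIntegrable s hs.1) hφR hG).trans ?_
    simp only [pow_zero, Nat.factorial_zero, Nat.cast_one, div_one, mul_one]
    gcongr
    exact hC s hs
  | succ N ih =>
    have hφs : HasCompactSupport φ := .of_isClosed_subset (isCompact_closedBall _ _)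
      (isClosed_tsupport φ) hφR
    set c := Fintype.card ι * (G * C) * k ^ (N + 1)
    have hB (x : ℝ) : HasDerivAt (fun x => c * (x ^ (N + 1) / (N + 1).factorial))
        (c * (x ^ N / N.factorial)) x := by
      convert! ((hasDerivAt_pow (N + 1) x).div_const ((N + 1).factorial : ℝ)).const_mul c using 2
      rw [Nat.factorial_succ, Nat.add_sub_cancel]
      push_cast
      field_simp
    rw [← mul_assoc]
    refine norm_le_of_norm_deriv_le (h.continuousOn φ hφ hφs) ?_ (by simp)
      (h.hasDerivAt φ hφ hφs) hB (fun x hx => ?_) hs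
    · refine integral_eq_zero_of_ae ?_
      filter_upwards [h0] with ξ hξ
      rw [hξ, Pi.zero_apply, Pi.zero_apply, dotProduct_zero]
    · simp only [Matrix.dotProduct_mulVec]
      have hsupp : Function.support (fun ξ => φ ξ ᵥ* A ξ) ⊆ Function.support φ :=
        fun ξ hξ h => hξ (by simp [h])
      have hkG (ξ : V) : ‖φ ξ ᵥ* A ξ‖ ≤ k * G := by
        by_cases hξ : ξ ∈ Metric.closedBall (0 : V) R
        · exact (hk ξ hξ _).trans (mul_le_mul_of_nonneg_left (hG ξ) hk0)
        · rw [image_eq_zero_of_notMem_tsupport (notMem_subset hφR hξ), Matrix.zero_vecMul,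
            norm_zero]
          positivity
      refine (ih ?_ ((closure_mono hsupp).trans hφR) hkG hx (by positivity)).trans_eq ?_
      · exact contDiff_pi.2 fun l => ContDiff.sum fun i _ => (contDiff_pi.1 hφ i).mul (hA i l)
      · ring

variable [BorelSpace V]

theorem integrable_dotProduct {f : V → ι → 𝕜} (hf : LocallyIntegrable f μ)
    (hφ : Continuous φ) (hφs : HasCompactSupport φ) :
    Integrable (fun ξ => φ ξ ⬝ᵥ f ξ) μ := by
  refine integrable_finsetSum _ fun i _ => ?_
  have hfi : LocallyIntegrable (fun ξ => f ξ i) μ :=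
    hf.mono ((continuous_apply i).comp_aestronglyMeasurable hf.aestronglyMeasurable)
      (.of_forall fun ξ => norm_le_pi_norm (f ξ) i)
  exact hfi.integrable_smul_left_of_hasCompactSupport ((continuous_apply i).comp hφ)
    (hφs.comp_left (g := fun v : ι → 𝕜 => v i) rfl)

theorem integral_dotProduct_sub {f₁ f₂ : V → ι → 𝕜} (hf₁ : LocallyIntegrable f₁ μ)
    (hf₂ : LocallyIntegrable f₂ μ) (hφ : Continuous φ) (hφs : HasCompactSupport φ) :
    ∫ ξ, φ ξ ⬝ᵥ (f₁ ξ - f₂ ξ) ∂μ = ∫ ξ, φ ξ ⬝ᵥ f₁ ξ ∂μ - ∫ ξ, φ ξ ⬝ᵥ f₂ ξ ∂μ := by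
  simp only [dotProduct_sub]
  exact integral_sub (integrable_dotProduct hf₁ hφ hφs) (integrable_dotProduct hf₂ hφ hφs)

theorem IsWeakSolution.sub (h₁ : IsWeakSolution μ A w₁) (h₂ : IsWeakSolution μ A w₂)
    (hA : Continuous A) : IsWeakSolution μ A fun t ξ => w₁ t ξ - w₂ t ξ where
  locallyIntegrable t ht := (h₁.locallyIntegrable t ht).sub (h₂.locallyIntegrable t ht)
  bounded T R := by
    have : ProperSpace V := FiniteDimensional.proper_real V
    obtain ⟨C₁, hC₁⟩ := h₁.bounded T R
    obtain ⟨C₂, hC₂⟩ := h₂.bounded T R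
    refine ⟨C₁ + C₂, fun t ht => le_trans ?_ (add_le_add (hC₁ t ht) (hC₂ t ht))⟩
    have hi₁ := (h₁.locallyIntegrable t ht.1).integrableOn_isCompact (isCompact_closedBall 0 R)
    have hi₂ := (h₂.locallyIntegrable t ht.1).integrableOn_isCompact (isCompact_closedBall 0 R)
    rw [← integral_add hi₁.norm hi₂.norm]
    exact setIntegral_mono (hi₁.sub hi₂).norm (hi₁.norm.add hi₂.norm) fun ξ => norm_sub_le _ _
  continuousOn φ hφ hφs :=
    ((h₁.continuousOn φ hφ hφs).sub (h₂.continuousOn φ hφ hφs)).congr fun t ht =>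
      integral_dotProduct_sub (h₁.locallyIntegrable t ht) (h₂.locallyIntegrable t ht)
        hφ.continuous hφs
  hasDerivAt φ hφ hφs t ht := by
    have hφA : Continuous fun ξ => φ ξ ᵥ* A ξ := hφ.continuous.matrix_vecMul hA
    have hφAs : HasCompactSupport fun ξ => φ ξ ᵥ* A ξ := hφs.mono fun ξ hξ h => hξ (by simp [h])
    have hd := (h₁.hasDerivAt φ hφ hφs t ht).sub (h₂.hasDerivAt φ hφ hφs t ht)
    simp only [Matrix.dotProduct_mulVec] at hd ⊢
    rw [integral_dotProduct_sub (h₁.locallyIntegrable t ht.le) (h₂.locallyIntegrable t ht.le)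
      hφA hφAs]
    refine hd.congr_of_eventuallyEq ?_
    filter_upwards [lt_mem_nhds ht] with s hs
    exact integral_dotProduct_sub (h₁.locallyIntegrable s hs.le) (h₂.locallyIntegrable s hs.le)
      hφ.continuous hφs

theorem IsWeakSolution.ae_eq_zero (h : IsWeakSolution μ A w)
    (hA : ∀ i l, ContDiff ℝ ∞ fun ξ => A ξ i l) (h0 : w 0 =ᵐ[μ] 0) {t : ℝ} (ht : 0 ≤ t) :
    w t =ᵐ[μ] 0 := by
  classical
  have : ProperSpace V := FiniteDimensional.proper_real V
  have integral_eq_zero (φ : V → ι → 𝕜) (hφ : ContDiff ℝ ∞ φ) (hφs : HasCompactSupport φ) :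
      ∫ ξ, φ ξ ⬝ᵥ w t ξ ∂μ = 0 := by
    obtain ⟨R, hR⟩ := hφs.isBounded.subset_closedBall 0
    obtain ⟨C, hC⟩ := h.bounded t R
    obtain ⟨k, hk⟩ := exists_norm_vecMul_le (continuous_matrix fun i l => (hA i l).continuous) R
    obtain ⟨G, hG⟩ := hφ.continuous.bounded_above_of_compact_support hφs
    have hk' : ∀ ξ ∈ Metric.closedBall (0 : V) R, ∀ u, ‖u ᵥ* A ξ‖ ≤ |k| * ‖u‖ := fun ξ hξ u =>
      (hk ξ hξ u).trans (mul_le_mul_of_nonneg_right (le_abs_self k) (norm_nonneg u))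
    have hlim : Tendsto (fun N : ℕ => Fintype.card ι * (G * C) * (|k| ^ N * (t ^ N / N.factorial)))
        atTop (𝓝 0) := by
      simpa only [← mul_div_assoc, ← mul_pow, mul_zero] using
        (FloorSemiring.tendsto_pow_div_factorial_atTop (|k| * t)).const_mul
          (Fintype.card ι * (G * C))
    exact norm_le_zero_iff.1 <| ge_of_tendsto' hlim fun N =>
      h.norm_integral_le_pow_div_factorial hA h0 hC hk' (abs_nonneg k) N hφ hR hG ⟨ht, le_rfl⟩
  refine ae_eq_zero_of_integral_contDiff_smul_eq_zero (h.locallyIntegrable t ht)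
    fun g hg hgs => ?_
  have hi : Integrable (fun ξ => g ξ • w t ξ) μ :=
    (h.locallyIntegrable t ht).integrable_smul_left_of_hasCompactSupport hg.continuous hgs
  ext i
  rw [eval_integral fun i => hi.eval i, Pi.zero_apply]
  have hφ : ContDiff ℝ ∞ fun ξ => Pi.single (M := fun _ : ι => 𝕜) i (g ξ : 𝕜) :=
    ((ContinuousLinearMap.single ℝ (fun _ : ι => 𝕜) i).comp RCLike.ofRealCLM).contDiff.comp hg
  have hφs : HasCompactSupport fun ξ => Pi.single (M := fun _ : ι => 𝕜) i (g ξ : 𝕜) :=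
    hgs.comp_left (g := fun r : ℝ => Pi.single (M := fun _ : ι => 𝕜) i (r : 𝕜)) (by simp)
  simpa only [single_dotProduct, Pi.smul_apply, RCLike.real_smul_eq_coe_mul]
    using integral_eq_zero _ hφ hφs

end WeakSolution

section Flow

open scoped Matrix.Norms.Operator

variable {V ι 𝕜 : Type*} [Fintype ι] [DecidableEq ι] [RCLike 𝕜]

/-- The value at time `t` of the solution of `u' = M u`, `u(0) = u₀`. -/
def flow (M : Matrix ι ι 𝕜) (t : ℝ) (u₀ : ι → 𝕜) : ι → 𝕜 :=
  NormedSpace.exp (t • M) *ᵥ u₀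

theorem flow_zero (M : Matrix ι ι 𝕜) (u₀ : ι → 𝕜) : flow M 0 u₀ = u₀ := by
  rw [flow, zero_smul, NormedSpace.exp_zero, Matrix.one_mulVec]

theorem hasDerivAt_flow (M : Matrix ι ι 𝕜) (u₀ : ι → 𝕜) (t : ℝ) :
    HasDerivAt (fun s => flow M s u₀) (M *ᵥ flow M t u₀) t := by
  have h := hasDerivAt_exp_smul_const' (𝕂 := ℝ) M t
  rw [flow, Matrix.mulVec_mulVec]
  refine hasDerivAt_pi.2 fun i => HasDerivAt.fun_sum fun l _ => ?_
  exact (hasDerivAt_pi.1 (hasDerivAt_pi.1 h i) l).mul_const (u₀ l)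

variable [TopologicalSpace V] {A : V → Matrix ι ι 𝕜}

theorem continuous_exp_smul (hA : Continuous A) :
    Continuous fun p : ℝ × V => NormedSpace.exp (p.1 • A p.2) := by
  let _ : NormedAlgebra ℚ (Matrix ι ι 𝕜) := NormedAlgebra.restrictScalars ℚ 𝕜 _
  exact (NormedSpace.exp_continuous (𝔸 := Matrix ι ι 𝕜)).comp
    (continuous_fst.smul (hA.comp continuous_snd))

theorem exists_norm_flow_le (hA : Continuous A) (T : ℝ) {K : Set V} (hK : IsCompact K) :
    ∃ C, 0 ≤ C ∧ ∀ s ∈ Icc (-T) T, ∀ ξ ∈ K, ∀ u₀ : ι → 𝕜, ‖flow (A ξ) s u₀‖ ≤ C * ‖u₀‖ := by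
  obtain ⟨C, hC⟩ := (isCompact_Icc.prod hK).exists_bound_of_continuousOn
    (continuous_exp_smul hA).continuousOn (s := Icc (-T) T ×ˢ K)
  refine ⟨max C 0, le_max_right _ _, fun s hs ξ hξ u₀ =>
    (Matrix.linfty_opNorm_mulVec _ _).trans ?_⟩
  gcongr
  exact (hC (s, ξ) ⟨hs, hξ⟩).trans (le_max_left _ _)

end Flow

section WeakFlow

variable {V ι 𝕜 : Type*} [NormedAddCommGroup V] [Fintype ι] [DecidableEq ι]
  [RCLike 𝕜] [MeasurableSpace V] [BorelSpace V] {μ : Measure V} {A : V → Matrix ι ι 𝕜}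
  {u₀ : V → ι → 𝕜} {w : ℝ → V → ι → 𝕜}

theorem locallyIntegrable_flow [ProperSpace V] (hA : Continuous A) (hu : LocallyIntegrable u₀ μ)
    (t : ℝ) : LocallyIntegrable (fun ξ => flow (A ξ) t (u₀ ξ)) μ := by
  have hcont : Continuous fun p : V × (ι → 𝕜) => flow (A p.1) t p.2 :=
    ((continuous_exp_smul hA).comp (continuous_const.prodMk continuous_fst)).matrix_mulVec
      continuous_snd
  refine locallyIntegrable_iff.2 fun K hK => ?_
  obtain ⟨C, -, hC⟩ := exists_norm_flow_le hA |t| hK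
  refine Integrable.mono' ((hu.integrableOn_isCompact hK).norm.const_mul C)
    (hcont.comp_aestronglyMeasurable
      (continuous_id.aestronglyMeasurable.prodMk hu.aestronglyMeasurable)).restrict ?_
  filter_upwards [ae_restrict_mem hK.measurableSet] with ξ hξ
  exact hC t ⟨neg_abs_le t, le_abs_self t⟩ ξ hξ _

variable [NormedSpace ℝ V] [FiniteDimensional ℝ V]

theorem hasDerivAt_integral_dotProduct_flow (hA : Continuous A) (hu : LocallyIntegrable u₀ μ)
    {φ : V → ι → 𝕜} (hφ : Continuous φ) (hφs : HasCompactSupport φ) (t : ℝ) :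
    HasDerivAt (fun s => ∫ ξ, φ ξ ⬝ᵥ flow (A ξ) s (u₀ ξ) ∂μ)
      (∫ ξ, φ ξ ⬝ᵥ (A ξ *ᵥ flow (A ξ) t (u₀ ξ)) ∂μ) t := by
  have : ProperSpace V := FiniteDimensional.proper_real V
  obtain ⟨C, -, hC⟩ := exists_norm_flow_le hA (|t| + 1) hφs.isCompact
  have hφA : Continuous fun ξ => φ ξ ᵥ* A ξ := hφ.matrix_vecMul hA
  have hφAs : HasCompactSupport fun ξ => φ ξ ᵥ* A ξ := hφs.mono fun ξ hξ h => hξ (by simp [h])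
  have hi (s : ℝ) := integrable_dotProduct (locallyIntegrable_flow hA hu s) hφ hφs
  have hiA := integrable_dotProduct (locallyIntegrable_flow hA hu t) hφA hφAs
  have hn : LocallyIntegrable (fun ξ => C * ‖u₀ ξ‖) μ :=
    (hu.mono hu.aestronglyMeasurable.norm (.of_forall fun ξ => (norm_norm _).le)).smul C
  have hb : Integrable (fun ξ => Fintype.card ι * (‖φ ξ ᵥ* A ξ‖ * (C * ‖u₀ ξ‖))) μ :=
    (hn.integrable_smul_left_of_hasCompactSupport hφA.norm hφAs.norm).const_mul _
  simp only [Matrix.dotProduct_mulVec]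
  refine (hasDerivAt_integral_of_dominated_loc_of_deriv_le (Metric.ball_mem_nhds t one_pos)
    (F' := fun s ξ => (φ ξ ᵥ* A ξ) ⬝ᵥ flow (A ξ) s (u₀ ξ))
    (.of_forall fun s => (hi s).aestronglyMeasurable) (hi t) hiA.aestronglyMeasurable
    (.of_forall fun ξ s hs => (norm_dotProduct_le _ _).trans ?_) hb
    (.of_forall fun ξ s _ => ?_)).2
  · by_cases hξ : ξ ∈ tsupport φ
    · have hs' : |s| ≤ |t| + 1 := by
        rw [Metric.mem_ball, Real.dist_eq] at hs
        linarith [abs_sub_abs_le_abs_sub s t]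
      gcongr
      exact hC s (abs_le.1 hs') ξ hξ _
    · simp [image_eq_zero_of_notMem_tsupport hξ]
  · rw [← Matrix.dotProduct_mulVec]
    exact HasDerivAt.fun_sum fun i _ =>
      (hasDerivAt_pi.1 (hasDerivAt_flow (A ξ) (u₀ ξ) s) i).const_mul (φ ξ i)

theorem isWeakSolution_flow (hA : Continuous A) (hu : LocallyIntegrable u₀ μ) :
    IsWeakSolution μ A fun t ξ => flow (A ξ) t (u₀ ξ) where
  locallyIntegrable t _ :=
    have : ProperSpace V := FiniteDimensional.proper_real V
    locallyIntegrable_flow hA hu t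
  bounded T R := by
    have : ProperSpace V := FiniteDimensional.proper_real V
    have hK := isCompact_closedBall (0 : V) R
    obtain ⟨C, -, hC⟩ := exists_norm_flow_le hA T hK
    refine ⟨∫ ξ in Metric.closedBall 0 R, C * ‖u₀ ξ‖ ∂μ, fun s hs => ?_⟩
    refine setIntegral_mono_on ((locallyIntegrable_flow hA hu s).integrableOn_isCompact hK).norm
      ((hu.integrableOn_isCompact hK).norm.const_mul C) hK.measurableSet fun ξ hξ => ?_
    exact hC s ⟨by linarith [hs.1, hs.2], hs.2⟩ ξ hξ _
  continuousOn φ hφ hφs := fun t _ =>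
    (hasDerivAt_integral_dotProduct_flow hA hu hφ.continuous hφs t).continuousAt.continuousWithinAt
  hasDerivAt φ hφ hφs t _ := hasDerivAt_integral_dotProduct_flow hA hu hφ.continuous hφs t

theorem IsWeakSolution.ae_eq_flow (h : IsWeakSolution μ A w)
    (hA : ∀ i l, ContDiff ℝ ∞ fun ξ => A ξ i l) {t : ℝ} (ht : 0 ≤ t) :
    w t =ᵐ[μ] fun ξ => flow (A ξ) t (w 0 ξ) := by
  have : ProperSpace V := FiniteDimensional.proper_real V
  have hAc : Continuous A := continuous_matrix fun i l => (hA i l).continuous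
  have hsub := h.sub (isWeakSolution_flow hAc (h.locallyIntegrable 0 le_rfl)) hAc
  have h0 := hsub.ae_eq_zero hA (.of_forall fun ξ => by simp [flow_zero]) ht
  filter_upwards [h0] with ξ hξ using sub_eq_zero.1 hξ

end WeakFlow

section Pairing

/-- The space `L²(ℝⁿ; F)`. -/
abbrev L2Space (n : ℕ) (F : Type*) [NormedAddCommGroup F] : Type _ :=
  Lp F 2 (volume : Measure (E n))

variable {n : ℕ}

/-- The `L²` Fourier transform of a real-valued function. -/
def spec (f : L2Space n ℝ) : L2Space n ℂ := 𝓕 (Complex.ofRealCLM.compLp f)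

theorem continuous_spec : Continuous (spec (n := n)) :=
  (Lp.fourierTransformₗᵢ (E n) ℂ).continuous.comp
    (Complex.ofRealCLM.compLpL 2 (volume : Measure (E n))).continuous

/-- The `j`-th component of a square integrable vector field. -/
def component (j : Fin n) (w : L2Space n (E n)) : L2Space n ℝ :=
  (EuclideanSpace.proj j : E n →L[ℝ] ℝ).compLp w

theorem coeFn_component (j : Fin n) (w : L2Space n (E n)) :
    component j w =ᵐ[volume] fun x => w x j :=
  (EuclideanSpace.proj j : E n →L[ℝ] ℝ).coeFn_compLp' w

theorem continuous_component (j : Fin n) : Continuous (component j) :=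
  ((EuclideanSpace.proj j : E n →L[ℝ] ℝ).compLpL 2 (volume : Measure (E n))).continuous

theorem integrable_mul_schwartz {𝕜 : Type*} [RCLike 𝕜] (f : L2Space n 𝕜) (φ : 𝓢(E n, 𝕜)) :
    Integrable fun x => φ x * f x :=
  (φ.memLp 2).integrable_mul (Lp.memLp f)

/-- The pairing of a real function with a complex Schwartz function. -/
def pair (f : L2Space n ℝ) (φ : 𝓢(E n, ℂ)) : ℂ := ∫ x, φ x * f x

theorem pair_eq_re_add_im (f : L2Space n ℝ) (φ : 𝓢(E n, ℂ)) :
    pair f φ = ((∫ x, postcompCLM Complex.reCLM φ x * f x : ℝ) : ℂ)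
      + ((∫ x, postcompCLM Complex.imCLM φ x * f x : ℝ) : ℂ) * Complex.I := by
  have hre := integrable_mul_schwartz f (postcompCLM Complex.reCLM φ)
  have him := integrable_mul_schwartz f (postcompCLM Complex.imCLM φ)
  rw [← integral_complex_ofReal, ← integral_complex_ofReal, ← integral_mul_const,
    ← integral_add hre.ofReal (him.ofReal.mul_const _), pair]
  refine integral_congr_ae (.of_forall fun x => ?_)
  simp only [postcompCLM_apply, Complex.reCLM_apply, Complex.imCLM_apply, Complex.ofReal_mul]
  conv_lhs => rw [← Complex.re_add_im (φ x)]
  ring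

theorem pair_fourier (f : L2Space n ℝ) (g : 𝓢(E n, ℂ)) :
    pair f (𝓕 g) = ∫ ξ, g ξ * spec f ξ := by
  have h := congrArg (fun T => T g)
    (Lp.fourier_toTemperedDistribution_eq (Complex.ofRealCLM.compLp f))
  simp only [TemperedDistribution.fourier_apply, Lp.toTemperedDistribution_apply,
    smul_eq_mul] at h
  rw [pair, spec, ← h]
  refine integral_congr_ae ?_
  filter_upwards [Complex.ofRealCLM.coeFn_compLp f] with x hx
  rw [hx, Complex.ofRealCLM_apply]

/-- The `j`-th partial derivative of a Schwartz function. -/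
abbrev partialDeriv {F : Type*} [NormedAddCommGroup F] [NormedSpace ℝ F]
    (j : Fin n) (φ : 𝓢(E n, F)) : 𝓢(E n, F) := ∂_{(EuclideanSpace.single j 1 : E n)} φ

theorem pd_schwartz (j : Fin n) (φ : 𝓢(E n, ℝ)) : pd j φ = ⇑(partialDeriv j φ) := rfl

theorem partialDeriv_postcompCLM (j : Fin n) (L : ℂ →L[ℝ] ℝ) (φ : 𝓢(E n, ℂ)) :
    partialDeriv j (postcompCLM L φ) = postcompCLM L (partialDeriv j φ) := by
  ext x
  rw [lineDerivOp_apply_eq_fderiv, postcompCLM_apply, lineDerivOp_apply_eq_fderiv]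
  exact congrArg (· (EuclideanSpace.single j 1))
    (L.hasFDerivAt.comp x (φ.hasFDerivAt x)).fderiv

/-- Multiplication of a Schwartz function by `-2πi` times the `k`-th coordinate, so that
`∂_k (𝓕 g) = 𝓕 (coordMul k g)`. -/
def coordMul (k : Fin n) (g : 𝓢(E n, ℂ)) : 𝓢(E n, ℂ) :=
  -(2 * π * Complex.I) • smulLeftCLM ℂ (inner ℝ · (EuclideanSpace.single k 1 : E n)) g

theorem coordMul_apply (k : Fin n) (g : 𝓢(E n, ℂ)) (ξ : E n) :
    coordMul k g ξ = -(2 * π * Complex.I) * (ξ k * g ξ) := by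
  have : (fun x : E n => inner ℝ x (EuclideanSpace.single k 1 : E n)).HasTemperateGrowth := by
    fun_prop
  simp only [coordMul, _root_.smul_apply, smulLeftCLM_apply_apply this, smul_eq_mul]
  simp [EuclideanSpace.inner_single_right]

theorem partialDeriv_fourier (k : Fin n) (g : 𝓢(E n, ℂ)) :
    partialDeriv k (𝓕 g) = 𝓕 (coordMul k g) :=
  lineDerivOp_fourier_eq g _

theorem integral_mul_component (j : Fin n) (w : L2Space n (E n)) (φ : E n → ℝ) :
    ∫ x, φ x * component j w x = ∫ x, w x j * φ x := by
  refine integral_congr_ae ?_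
  filter_upwards [coeFn_component j w] with x hx
  rw [hx, mul_comm]

theorem integrable_component_mul (j : Fin n) (w : L2Space n (E n)) (φ : 𝓢(E n, ℝ)) :
    Integrable fun x => w x j * φ x := by
  refine (integrable_mul_schwartz (component j w) φ).congr ?_
  filter_upwards [coeFn_component j w] with x hx
  rw [hx, mul_comm]

end Pairing

section ComplexPairing

variable {n : ℕ} {α β γ : ℝ} {ρ₀ : L2Space n ℝ} {v₀ : L2Space n (E n)} {ρ : ℝ → L2Space n ℝ}
  {v : ℝ → L2Space n (E n)} {t : ℝ}

theorem IsSolution.hasDerivAt_integral_density (h : IsSolution α β γ ρ₀ v₀ ρ v)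
    (φ : 𝓢(E n, ℝ)) (ht : 0 < t) :
    HasDerivAt (fun s => ∫ x, φ x * ρ s x)
      (γ * ∑ k, ∫ x, partialDeriv k φ x * component k (v t) x) t := by
  have hm := h.mass φ t ht
  simp only [pd_schwartz] at hm
  rw [integral_const_mul, integral_finsetSum _ fun k _ => integrable_component_mul k _ _] at hm
  simpa only [integral_mul_component, mul_comm (φ _)] using hm

theorem IsSolution.hasDerivAt_integral_velocity (h : IsSolution α β γ ρ₀ v₀ ρ v) (j : Fin n)
    (φ : 𝓢(E n, ℝ)) (ht : 0 < t) :
    HasDerivAt (fun s => ∫ x, φ x * component j (v s) x)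
      (α * (∑ k, ∫ x, partialDeriv k (partialDeriv k φ) x * component j (v t) x)
        + β * (∑ k, ∫ x, partialDeriv k (partialDeriv j φ) x * component k (v t) x)
        + γ * ∫ x, partialDeriv j φ x * ρ t x) t := by
  have hm := h.momentum j φ t ht
  have hlap (x : E n) :
      v t x j * lap φ x = ∑ k, v t x j * partialDeriv k (partialDeriv k φ) x := Finset.mul_sum ..
  simp only [hlap, pd_schwartz] at hm
  have hα : Integrable fun x => ∑ k, v t x j * partialDeriv k (partialDeriv k φ) x :=
    integrable_finsetSum _ fun k _ => integrable_component_mul j _ _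
  have hβ : Integrable fun x => ∑ k, v t x k * partialDeriv k (partialDeriv j φ) x :=
    integrable_finsetSum _ fun k _ => integrable_component_mul k _ _
  have hγ : Integrable fun x => ρ t x * partialDeriv j φ x := by
    simpa only [mul_comm] using integrable_mul_schwartz (ρ t) (partialDeriv j φ)
  rw [integral_add (f := fun x => _ + _) ((hα.const_mul α).add (hβ.const_mul β)) (hγ.const_mul γ),
    integral_add (hα.const_mul α) (hβ.const_mul β), integral_const_mul, integral_const_mul,
    integral_const_mul, integral_finsetSum _ fun k _ => integrable_component_mul j _ _,
    integral_finsetSum _ fun k _ => integrable_component_mul k _ _] at hm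
  simpa only [integral_mul_component, mul_comm (partialDeriv j φ _)] using hm

theorem IsSolution.hasDerivAt_pair_density (h : IsSolution α β γ ρ₀ v₀ ρ v) (φ : 𝓢(E n, ℂ))
    (ht : 0 < t) :
    HasDerivAt (fun s => pair (ρ s) φ)
      (γ * ∑ k, pair (component k (v t)) (partialDeriv k φ)) t := by
  have hre := (h.hasDerivAt_integral_density (postcompCLM Complex.reCLM φ) ht).ofReal_comp
  have him := (h.hasDerivAt_integral_density (postcompCLM Complex.imCLM φ) ht).ofReal_comp
  simp only [pair_eq_re_add_im, ← partialDeriv_postcompCLM]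
  convert! hre.add (him.mul_const Complex.I) using 1
  push_cast
  rw [Finset.sum_add_distrib, ← Finset.sum_mul]
  ring

theorem IsSolution.hasDerivAt_pair_velocity (h : IsSolution α β γ ρ₀ v₀ ρ v) (j : Fin n)
    (φ : 𝓢(E n, ℂ)) (ht : 0 < t) :
    HasDerivAt (fun s => pair (component j (v s)) φ)
      (α * ∑ k, pair (component j (v t)) (partialDeriv k (partialDeriv k φ))
        + β * ∑ k, pair (component k (v t)) (partialDeriv k (partialDeriv j φ))
        + γ * pair (ρ t) (partialDeriv j φ)) t := by
  have hre := (h.hasDerivAt_integral_velocity j (postcompCLM Complex.reCLM φ) ht).ofReal_comp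
  have him := (h.hasDerivAt_integral_velocity j (postcompCLM Complex.imCLM φ) ht).ofReal_comp
  simp only [pair_eq_re_add_im, ← partialDeriv_postcompCLM]
  convert! hre.add (him.mul_const Complex.I) using 1
  push_cast
  rw [Finset.sum_add_distrib, Finset.sum_add_distrib, ← Finset.sum_mul, ← Finset.sum_mul]
  ring

end ComplexPairing

section Symbol

variable {n : ℕ}

/-- The symbol of the system acting on the Fourier transforms of the density (index `none`) and of
the velocity components. With the normalization `exp (-2πi x·ξ)` of the Fourier transform, the
coefficients are `a = 4π²α`, `b = 4π²β` and `c = 2πγ`. -/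
def symbol (a b c : ℝ) (ξ : E n) : Matrix (Option (Fin n)) (Option (Fin n)) ℂ
  | none, none => 0
  | none, some k => -(Complex.I * c * ξ k)
  | some j, none => -(Complex.I * c * ξ j)
  | some j, some k => -((if j = k then a * ‖ξ‖ ^ 2 else 0 : ℝ) + b * (ξ j * ξ k))

/-- The longitudinal part `ξ · u` of the velocity of a Fourier mode. -/
def longitudinal (ξ : E n) (u : Option (Fin n) → ℂ) : ℂ := ∑ k, (ξ k : ℂ) * u (some k)

variable (a b c : ℝ)

theorem contDiff_symbol (i l : Option (Fin n)) :
    ContDiff ℝ ∞ fun ξ : E n => symbol a b c ξ i l := by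
  have hcoord (k : Fin n) : ContDiff ℝ ∞ fun ξ : E n => (ξ k : ℂ) :=
    (Complex.ofRealCLM ∘L (EuclideanSpace.proj k : E n →L[ℝ] ℝ)).contDiff
  have hdiag (j k : Fin n) :
      ContDiff ℝ ∞ fun ξ : E n => ((if j = k then a * ‖ξ‖ ^ 2 else 0 : ℝ) : ℂ) := by
    split_ifs
    · exact Complex.ofRealCLM.contDiff.comp (contDiff_const.mul (contDiff_norm_sq ℝ))
    · exact contDiff_const
  match i, l with
  | none, none => exact contDiff_const
  | none, some k => exact (contDiff_const.mul (hcoord k)).neg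
  | some j, none => exact (contDiff_const.mul (hcoord j)).neg
  | some j, some k => exact ((hdiag j k).add (contDiff_const.mul ((hcoord j).mul (hcoord k)))).neg

variable (ξ : E n) (u : Option (Fin n) → ℂ)

theorem symbol_mulVec_none :
    (symbol a b c ξ *ᵥ u) none = -(Complex.I * c * longitudinal ξ u) := by
  simp only [Matrix.mulVec, dotProduct, Fintype.sum_option, symbol, longitudinal, zero_mul,
    zero_add, Finset.mul_sum, ← Finset.sum_neg_distrib]
  exact Finset.sum_congr rfl fun k _ => by ring

theorem symbol_mulVec_some (j : Fin n) :
    (symbol a b c ξ *ᵥ u) (some j) = -(a * ‖ξ‖ ^ 2 * u (some j) + b * ξ j * longitudinal ξ u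
      + Complex.I * c * ξ j * u none) := by
  have hlong : ∑ k, b * (ξ j * ξ k) * u (some k) = b * ξ j * longitudinal ξ u := by
    rw [longitudinal, Finset.mul_sum]
    exact Finset.sum_congr rfl fun k _ => by ring
  simp only [Matrix.mulVec, dotProduct, Fintype.sum_option, symbol, neg_mul, add_mul,
    Finset.sum_neg_distrib, Finset.sum_add_distrib, hlong, apply_ite Complex.ofReal,
    Complex.ofReal_zero, ite_mul, zero_mul, Finset.sum_ite_eq, Finset.mem_univ, if_true]
  push_cast
  ring

theorem ofReal_norm_sq : (‖ξ‖ : ℂ) ^ 2 = ∑ k, (ξ k : ℂ) ^ 2 := by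
  rw [← Complex.ofReal_pow, EuclideanSpace.real_norm_sq_eq]
  push_cast
  rfl

end Symbol

section SpecState

variable {n : ℕ} {α β γ : ℝ} {ρ₀ : L2Space n ℝ} {v₀ : L2Space n (E n)} {ρ : ℝ → L2Space n ℝ}
  {v : ℝ → L2Space n (E n)} {t : ℝ}

/-- A density and a velocity field as one family of scalar functions. -/
def state (r : L2Space n ℝ) (w : L2Space n (E n)) : Option (Fin n) → L2Space n ℝ
  | none => r
  | some j => component j w

/-- The Fourier mode of the frequency `ξ`: the Fourier transforms at `ξ` of the density and of the
velocity components. -/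
def specState (r : L2Space n ℝ) (w : L2Space n (E n)) (ξ : E n) (i : Option (Fin n)) : ℂ :=
  spec (state r w i) ξ

theorem IsSolution.continuousOn_state (h : IsSolution α β γ ρ₀ v₀ ρ v) (i : Option (Fin n)) :
    ContinuousOn (fun s => state (ρ s) (v s) i) (Ici 0) := by
  cases i with
  | none => exact h.continuousOn_density
  | some j => exact (continuous_component j).comp_continuousOn h.continuousOn_velocity

theorem IsSolution.hasDerivAt_integral_density_spec (h : IsSolution α β γ ρ₀ v₀ ρ v)
    (g : 𝓢(E n, ℂ)) (ht : 0 < t) :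
    HasDerivAt (fun s => ∫ ξ, g ξ * specState (ρ s) (v s) ξ none)
      (∫ ξ, g ξ * (symbol (4 * π ^ 2 * α) (4 * π ^ 2 * β) (2 * π * γ) ξ *ᵥ
        specState (ρ t) (v t) ξ) none) t := by
  have hp := h.hasDerivAt_pair_density (𝓕 g) ht
  simp only [partialDeriv_fourier, pair_fourier] at hp
  convert! hp using 1
  rw [← integral_finsetSum _ fun k _ => integrable_mul_schwartz _ _, ← integral_const_mul]
  refine integral_congr_ae (.of_forall fun ξ => ?_)
  simp only [symbol_mulVec_none, coordMul_apply, longitudinal, specState, state, Finset.mul_sum,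
    ← Finset.sum_neg_distrib]
  refine Finset.sum_congr rfl fun k _ => ?_
  push_cast
  ring

theorem IsSolution.hasDerivAt_integral_velocity_spec (h : IsSolution α β γ ρ₀ v₀ ρ v)
    (j : Fin n) (g : 𝓢(E n, ℂ)) (ht : 0 < t) :
    HasDerivAt (fun s => ∫ ξ, g ξ * specState (ρ s) (v s) ξ (some j))
      (∫ ξ, g ξ * (symbol (4 * π ^ 2 * α) (4 * π ^ 2 * β) (2 * π * γ) ξ *ᵥ
        specState (ρ t) (v t) ξ) (some j)) t := by
  have hp := h.hasDerivAt_pair_velocity j (𝓕 g) ht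
  simp only [partialDeriv_fourier, pair_fourier] at hp
  convert! hp using 1
  have hα := integrable_finsetSum Finset.univ fun k _ =>
    integrable_mul_schwartz (spec (component j (v t))) (coordMul k (coordMul k g))
  have hβ := integrable_finsetSum Finset.univ fun k _ =>
    integrable_mul_schwartz (spec (component k (v t))) (coordMul k (coordMul j g))
  have hγ := integrable_mul_schwartz (spec (ρ t)) (coordMul j g)
  rw [← integral_finsetSum _ fun k _ => integrable_mul_schwartz _ _,
    ← integral_finsetSum _ fun k _ => integrable_mul_schwartz _ _, ← integral_const_mul,
    ← integral_const_mul, ← integral_const_mul,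
    ← integral_add (hα.const_mul _) (hβ.const_mul _),
    ← integral_add (f := fun ξ => _ + _) ((hα.const_mul _).add (hβ.const_mul _))
      (hγ.const_mul _)]
  refine integral_congr_ae (.of_forall fun ξ => ?_)
  have hlap : ∑ k, coordMul k (coordMul k g) ξ * spec (component j (v t)) ξ
      = -(4 * π ^ 2) * (‖ξ‖ ^ 2 * (g ξ * spec (component j (v t)) ξ)) := by
    rw [ofReal_norm_sq, Finset.sum_mul, Finset.mul_sum]
    refine Finset.sum_congr rfl fun k _ => ?_
    simp only [coordMul_apply]
    linear_combination (4 * π ^ 2 * ξ k ^ 2 * g ξ * spec (component j (v t)) ξ) * Complex.I_sq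
  have hdiv : ∑ k, coordMul k (coordMul j g) ξ * spec (component k (v t)) ξ
      = -(4 * π ^ 2) * (ξ j * g ξ * ∑ k, ξ k * spec (component k (v t)) ξ) := by
    rw [Finset.mul_sum, Finset.mul_sum]
    refine Finset.sum_congr rfl fun k _ => ?_
    simp only [coordMul_apply]
    linear_combination
      (4 * π ^ 2 * ξ k * ξ j * g ξ * spec (component k (v t)) ξ) * Complex.I_sq
  simp only [symbol_mulVec_some, hlap, hdiv, longitudinal, specState, state]
  rw [coordMul_apply]
  push_cast
  ring

theorem IsSolution.hasDerivAt_integral_spec (h : IsSolution α β γ ρ₀ v₀ ρ v)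
    (g : 𝓢(E n, ℂ)) (i : Option (Fin n)) (ht : 0 < t) :
    HasDerivAt (fun s => ∫ ξ, g ξ * specState (ρ s) (v s) ξ i)
      (∫ ξ, g ξ * (symbol (4 * π ^ 2 * α) (4 * π ^ 2 * β) (2 * π * γ) ξ *ᵥ
        specState (ρ t) (v t) ξ) i) t := by
  cases i with
  | none => exact h.hasDerivAt_integral_density_spec g ht
  | some j => exact h.hasDerivAt_integral_velocity_spec j g ht

theorem locallyIntegrable_specState (r : L2Space n ℝ) (w : L2Space n (E n)) :
    LocallyIntegrable (specState r w) :=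
  locallyIntegrable_iff.2 fun _ hK => Integrable.of_eval fun _ =>
    ((Lp.memLp _).locallyIntegrable one_le_two).integrableOn_isCompact hK

theorem norm_le_sum_norm_apply {ι : Type*} {G : ι → Type*} [Fintype ι]
    [∀ i, SeminormedAddGroup (G i)] (u : ∀ i, G i) : ‖u‖ ≤ ∑ i, ‖u i‖ :=
  (pi_norm_le_iff_of_nonneg (Finset.sum_nonneg fun _ _ => norm_nonneg _)).2 fun i =>
    Finset.single_le_sum (f := fun i => ‖u i‖) (fun _ _ => norm_nonneg _) (Finset.mem_univ i)

theorem setIntegral_norm_specState_le (r : L2Space n ℝ) (w : L2Space n (E n)) {s : Set (E n)}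
    (hs : IsCompact s) : ∫ ξ in s, ‖specState r w ξ‖
      ≤ ∑ i, (volume.real s + ‖spec (state r w i)‖ ^ 2) := by
  have hi (i : Option (Fin n)) : IntegrableOn (fun ξ => ‖specState r w ξ i‖) s :=
    (((Lp.memLp _).locallyIntegrable one_le_two).integrableOn_isCompact hs).norm
  calc ∫ ξ in s, ‖specState r w ξ‖ ≤ ∫ ξ in s, ∑ i, ‖specState r w ξ i‖ :=
        setIntegral_mono ((locallyIntegrable_specState r w).integrableOn_isCompact hs).norm
          (integrable_finsetSum _ fun i _ => hi i) fun ξ => norm_le_sum_norm_apply _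
    _ = ∑ i, ∫ ξ in s, ‖specState r w ξ i‖ := integral_finsetSum _ fun i _ => hi i
    _ ≤ _ := Finset.sum_le_sum fun i _ => setIntegral_norm_le _ hs.measure_lt_top.ne

theorem IsSolution.isWeakSolution_specState (h : IsSolution α β γ ρ₀ v₀ ρ v) :
    IsWeakSolution volume (symbol (4 * π ^ 2 * α) (4 * π ^ 2 * β) (2 * π * γ))
      fun t => specState (ρ t) (v t) where
  locallyIntegrable t _ := locallyIntegrable_specState _ _
  bounded T R := by
    have hcont : ContinuousOn (fun t => ∑ i, (volume.real (Metric.closedBall (0 : E n) R)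
        + ‖spec (state (ρ t) (v t) i)‖ ^ 2)) (Icc 0 T) :=
      continuousOn_finsetSum _ fun i _ => (((continuous_spec.comp_continuousOn
        (h.continuousOn_state i)).mono Icc_subset_Ici_self).norm.pow 2).const_add _
    obtain ⟨C, hC⟩ := isCompact_Icc.bddAbove_image hcont
    exact ⟨C, fun t ht => (setIntegral_norm_specState_le _ _ (isCompact_closedBall 0 R)).trans
      (hC (mem_image_of_mem _ ht))⟩
  continuousOn φ hφ hφs := by
    have hi (i : Option (Fin n)) : MemLp (fun ξ => φ ξ i) 2 :=
      (contDiff_pi.1 hφ i).continuous.memLp_of_hasCompactSupport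
        (hφs.comp_left (g := fun u : Option (Fin n) → ℂ => u i) rfl)
    have hsum (t : ℝ) : ∫ ξ, φ ξ ⬝ᵥ specState (ρ t) (v t) ξ
        = ∑ i, ∫ ξ, φ ξ i * spec (state (ρ t) (v t) i) ξ :=
      integral_finsetSum _ fun i _ => (hi i).integrable_mul (Lp.memLp _)
    simp only [hsum]
    exact continuousOn_finsetSum _ fun i _ => (continuous_integral_mul (hi i)).comp_continuousOn
      (continuous_spec.comp_continuousOn (h.continuousOn_state i))
  hasDerivAt φ hφ hφs t ht := by
    have hφis (i : Option (Fin n)) : HasCompactSupport fun ξ => φ ξ i :=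
      hφs.comp_left (g := fun u : Option (Fin n) → ℂ => u i) rfl
    let ψ (i : Option (Fin n)) : 𝓢(E n, ℂ) := (hφis i).toSchwartzMap (contDiff_pi.1 hφ i)
    have hA (i : Option (Fin n)) : Integrable fun ξ => φ ξ i *
        (symbol (4 * π ^ 2 * α) (4 * π ^ 2 * β) (2 * π * γ) ξ *ᵥ specState (ρ t) (v t) ξ) i := by
      have hrow : Continuous (symbol (n := n) (4 * π ^ 2 * α) (4 * π ^ 2 * β) (2 * π * γ) · i) :=
        continuous_pi fun l => (contDiff_symbol _ _ _ i l).continuous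
      simpa only [Pi.smul_apply', smul_dotProduct, smul_eq_mul, Matrix.mulVec] using
        integrable_dotProduct (locallyIntegrable_specState (ρ t) (v t))
          ((contDiff_pi.1 hφ i).continuous.smul hrow) (hφis i).smul_right
    have hsum (s : ℝ) : ∫ ξ, φ ξ ⬝ᵥ specState (ρ s) (v s) ξ
        = ∑ i, ∫ ξ, ψ i ξ * specState (ρ s) (v s) ξ i :=
      integral_finsetSum _ fun i _ => integrable_mul_schwartz _ (ψ i)
    simp only [hsum]
    rw [show ∫ ξ, φ ξ ⬝ᵥ _ = _ from integral_finsetSum _ fun i _ => hA i]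
    exact HasDerivAt.fun_sum fun i _ => h.hasDerivAt_integral_spec (ψ i) i ht

theorem IsSolution.specState_ae_eq_flow (h : IsSolution α β γ ρ₀ v₀ ρ v) (ht : 0 ≤ t) :
    specState (ρ t) (v t) =ᵐ[volume] fun ξ =>
      flow (symbol (4 * π ^ 2 * α) (4 * π ^ 2 * β) (2 * π * γ) ξ) t (specState ρ₀ v₀ ξ) := by
  have := h.isWeakSolution_specState.ae_eq_flow (contDiff_symbol _ _ _) ht
  rwa [h.initial_density, h.initial_velocity] at this

end SpecState

section Energy

variable {n : ℕ}

/-- The energy of the velocity part of a Fourier mode. -/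
def kinetic (u : Option (Fin n) → ℂ) : ℝ := ∑ k, ‖u (some k)‖ ^ 2

/-- The total energy of a Fourier mode. -/
def energy (u : Option (Fin n) → ℂ) : ℝ := ∑ i, ‖u i‖ ^ 2

/-- The cross term between the density and the longitudinal velocity. Added to the energy with a
small weight, it transfers the viscous dissipation of the velocity to the density, which has none
of its own. -/
def cross (ξ : E n) (u : Option (Fin n) → ℂ) : ℝ := (conj (u none) * longitudinal ξ u).im

theorem kinetic_nonneg (u : Option (Fin n) → ℂ) : 0 ≤ kinetic u :=
  Finset.sum_nonneg fun _ _ => sq_nonneg _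

theorem energy_eq_add_kinetic (u : Option (Fin n) → ℂ) : energy u = ‖u none‖ ^ 2 + kinetic u :=
  Fintype.sum_option _

variable (a b c : ℝ) (ξ : E n) (u : Option (Fin n) → ℂ)

theorem norm_longitudinal_sq_le : ‖longitudinal ξ u‖ ^ 2 ≤ ‖ξ‖ ^ 2 * kinetic u := by
  calc ‖longitudinal ξ u‖ ^ 2 ≤ (∑ k, ‖(ξ k : ℂ) * u (some k)‖) ^ 2 := by
        gcongr
        exact norm_sum_le _ _
    _ = (∑ k, ‖ξ k‖ * ‖u (some k)‖) ^ 2 := by simp only [norm_mul, Complex.norm_real]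
    _ ≤ (∑ k, ‖ξ k‖ ^ 2) * kinetic u := Finset.sum_mul_sq_le_sq_mul_sq _ _ _
    _ = ‖ξ‖ ^ 2 * kinetic u := by rw [EuclideanSpace.norm_sq_eq]

theorem cross_sq_le : cross ξ u ^ 2 ≤ ‖ξ‖ ^ 2 * (‖u none‖ ^ 2 * kinetic u) := by
  calc cross ξ u ^ 2 = |cross ξ u| ^ 2 := (sq_abs _).symm
    _ ≤ ‖conj (u none) * longitudinal ξ u‖ ^ 2 := by
        gcongr
        exact Complex.abs_im_le_norm _
    _ = ‖u none‖ ^ 2 * ‖longitudinal ξ u‖ ^ 2 := by rw [norm_mul, Complex.norm_conj, mul_pow]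
    _ ≤ ‖u none‖ ^ 2 * (‖ξ‖ ^ 2 * kinetic u) := by
        gcongr
        exact norm_longitudinal_sq_le ξ u
    _ = ‖ξ‖ ^ 2 * (‖u none‖ ^ 2 * kinetic u) := by ring

theorem longitudinal_symbol_mulVec :
    longitudinal ξ (symbol a b c ξ *ᵥ u) =
      -((a + b) * ‖ξ‖ ^ 2 * longitudinal ξ u + Complex.I * c * ‖ξ‖ ^ 2 * u none) := by
  have hterm (k : Fin n) : (ξ k : ℂ) * (symbol a b c ξ *ᵥ u) (some k)
      = -(a * ‖ξ‖ ^ 2 * (ξ k * u (some k))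
        + (ξ k : ℂ) ^ 2 * (b * longitudinal ξ u + Complex.I * c * u none)) := by
    rw [symbol_mulVec_some]
    ring
  rw [longitudinal]
  simp only [hterm, Finset.sum_neg_distrib, Finset.sum_add_distrib, ← Finset.mul_sum,
    ← Finset.sum_mul, ← ofReal_norm_sq]
  rw [← longitudinal]
  ring

theorem star_dotProduct_symbol_mulVec :
    star u ⬝ᵥ (symbol a b c ξ *ᵥ u) = -(a * ‖ξ‖ ^ 2 * kinetic u + b * ‖longitudinal ξ u‖ ^ 2
      + Complex.I * c * (2 * (conj (u none) * longitudinal ξ u).re : ℝ)) := by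
  have hterm (k : Fin n) : conj (u (some k)) * (symbol a b c ξ *ᵥ u) (some k)
      = -(a * ‖ξ‖ ^ 2 * (‖u (some k)‖ ^ 2 : ℝ)
        + conj ((ξ k : ℂ) * u (some k)) * (b * longitudinal ξ u + Complex.I * c * u none)) := by
    rw [symbol_mulVec_some, Complex.ofReal_pow, ← Complex.conj_mul', map_mul, Complex.conj_ofReal]
    ring
  simp only [dotProduct, Fintype.sum_option, Pi.star_apply, RCLike.star_def, hterm,
    symbol_mulVec_none, Finset.sum_neg_distrib, Finset.sum_add_distrib, ← Finset.mul_sum,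
    ← Finset.sum_mul, ← map_sum]
  rw [← longitudinal, ← Complex.ofReal_sum, ← kinetic, ← Complex.add_conj, map_mul,
    Complex.conj_conj, ← Complex.conj_mul']
  ring

end Energy

section EnergyDecay

theorem le_exp_mul_of_deriv_le {L L' : ℝ → ℝ} {κ : ℝ} (hL : ∀ t, HasDerivAt L (L' t) t)
    (h : ∀ t, L' t ≤ -κ * L t) {t : ℝ} (ht : 0 ≤ t) : L t ≤ L 0 * Real.exp (-κ * t) := by
  have := le_gronwallBound_of_liminf_deriv_right_le (a := 0) (b := t) (K := -κ) (ε := 0)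
    (HasDerivAt.continuousOn fun s _ => hL s)
    (fun s _ r hr => (hL s).hasDerivWithinAt.liminf_right_slope_le hr) le_rfl
    (fun s _ => (h s).trans_eq (add_zero _).symm) t ⟨ht, le_rfl⟩
  rwa [gronwallBound_ε0, sub_zero] at this

theorem four_mul_abs_mul_le_add {x m k X w : ℝ} (hm : 0 ≤ m) (hk : 0 ≤ k) (hw : 0 ≤ w)
    (hw2 : w ≤ 1 / 2) (hwx : w * x ≤ 1 / 2) (hX : X ^ 2 ≤ x * (m * k)) :
    4 * (w * |X|) ≤ m + k := by
  have hw2x : 4 * (w * (w * x)) ≤ 1 := by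
    linarith [mul_le_mul_of_nonneg_left hwx hw]
  have hsq : (2 * (w * |X|)) ^ 2 ≤ m * k := by
    calc (2 * (w * |X|)) ^ 2 = 4 * w ^ 2 * X ^ 2 := by rw [← sq_abs X]; ring
      _ ≤ 4 * w ^ 2 * (x * (m * k)) := by gcongr
      _ = 4 * (w * (w * x)) * (m * k) := by ring
      _ ≤ m * k := mul_le_of_le_one_left (mul_nonneg hm hk) hw2x
  linarith [two_mul_le_add_of_sq_le_mul hm hk hsq]

/-- Here `m` and `k` are the energies of the density and of the velocity, `q` is the modulus of
the longitudinal part, `X` is the cross term, `x = |ξ|²`, and `w` is the weight of the cross term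
in the modified energy. -/
theorem modified_energy_dissipation {c d ν ε x m k q X w : ℝ} (hc : 0 < c) (hε : ε ≤ 1 / 2)
    (hεd : ε * (2 * c + ν ^ 2 / c) ≤ d) (hw : 0 ≤ w) (hwε : w ≤ ε) (hwx : w * x ≤ ε)
    (hx : 0 ≤ x) (hm : 0 ≤ m) (hk : 0 ≤ k) (hq : q ^ 2 ≤ x * k) (hX : X ^ 2 ≤ x * (m * k)) :
    -2 * d * (x * k) + 2 * w * (c * q ^ 2 - c * x * m - ν * x * X)
      ≤ -(w * c * x / 2) * (m + k + 2 * w * X) := by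
  have hxk : 0 ≤ x * k := mul_nonneg hx hk
  have hν : 2 * -(ν * X) ≤ c * m + ν ^ 2 / c * (x * k) := by
    refine two_mul_le_add_of_sq_le_mul (by positivity) (by positivity) ?_
    calc (-(ν * X)) ^ 2 = ν ^ 2 * X ^ 2 := by ring
      _ ≤ ν ^ 2 * (x * (m * k)) := by gcongr
      _ = c * m * (ν ^ 2 / c * (x * k)) := by field_simp
  have htransfer : 2 * w * -(ν * x * X) ≤ w * c * x * m + ε * (ν ^ 2 / c) * (x * k) := by
    calc 2 * w * -(ν * x * X) = w * x * (2 * -(ν * X)) := by ring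
      _ ≤ w * x * (c * m + ν ^ 2 / c * (x * k)) := by gcongr
      _ = w * c * x * m + w * x * (ν ^ 2 / c * (x * k)) := by ring
      _ ≤ w * c * x * m + ε * (ν ^ 2 / c * (x * k)) := by gcongr
      _ = w * c * x * m + ε * (ν ^ 2 / c) * (x * k) := by ring
  have hε0 : 0 ≤ ε := hw.trans hwε
  have hlong : 2 * w * (c * q ^ 2) ≤ 2 * (ε * c) * (x * k) := by
    calc 2 * w * (c * q ^ 2) ≤ 2 * ε * (c * (x * k)) := by gcongr
      _ = 2 * (ε * c) * (x * k) := by ring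
  have hwc : 2 * (w * c) ≤ d := by
    have : 0 ≤ ε * (ν ^ 2 / c) := mul_nonneg hε0 (by positivity)
    have : w * c ≤ ε * c := by gcongr
    linarith
  have hmod : 2 * w * X ≤ (m + k) / 2 := by
    have := four_mul_abs_mul_le_add hm hk hw (hwε.trans hε) (hwx.trans hε) hX
    linarith [mul_le_mul_of_nonneg_left (le_abs_self X) hw]
  have hwcx : 0 ≤ w * c * x := by positivity
  nlinarith [mul_le_mul_of_nonneg_right hεd hxk, mul_le_mul_of_nonneg_right hwc hxk,
    mul_le_mul_of_nonneg_left hmod hwcx, mul_nonneg hwcx hm]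

variable {n : ℕ} {a b c : ℝ} {ξ : E n} {u : ℝ → Option (Fin n) → ℂ}

/-- The evolution of the Fourier mode of frequency `ξ`. -/
def IsMode (a b c : ℝ) (ξ : E n) (u : ℝ → Option (Fin n) → ℂ) : Prop :=
  ∀ t, HasDerivAt u (symbol a b c ξ *ᵥ u t) t

theorem isMode_flow (a b c : ℝ) (ξ : E n) (u₀ : Option (Fin n) → ℂ) :
    IsMode a b c ξ fun t => flow (symbol a b c ξ) t u₀ :=
  hasDerivAt_flow _ u₀

theorem IsMode.hasDerivAt_none (h : IsMode a b c ξ u) (t : ℝ) :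
    HasDerivAt (fun s => u s none) (-(Complex.I * c * longitudinal ξ (u t))) t := by
  have := hasDerivAt_pi.1 (h t) none
  rwa [symbol_mulVec_none] at this

theorem IsMode.hasDerivAt_longitudinal (h : IsMode a b c ξ u) (t : ℝ) :
    HasDerivAt (fun s => longitudinal ξ (u s)) (-((a + b) * ‖ξ‖ ^ 2 * longitudinal ξ (u t)
      + Complex.I * c * ‖ξ‖ ^ 2 * u t none)) t := by
  rw [← longitudinal_symbol_mulVec]
  exact HasDerivAt.fun_sum fun k _ => (hasDerivAt_pi.1 (h t) (some k)).const_mul _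

theorem IsMode.hasDerivAt_energy (h : IsMode a b c ξ u) (t : ℝ) :
    HasDerivAt (fun s => energy (u s))
      (-2 * (a * ‖ξ‖ ^ 2 * kinetic (u t) + b * ‖longitudinal ξ (u t)‖ ^ 2)) t := by
  have hsq (i : Option (Fin n)) := (hasDerivAt_pi.1 (h t) i).norm_sq
  have hre : (star (u t) ⬝ᵥ (symbol a b c ξ *ᵥ u t)).re
      = -(a * ‖ξ‖ ^ 2 * kinetic (u t) + b * ‖longitudinal ξ (u t)‖ ^ 2) := by
    rw [star_dotProduct_symbol_mulVec]
    simp [← Complex.ofReal_pow]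
  convert! HasDerivAt.fun_sum fun i (_ : i ∈ Finset.univ) => hsq i using 1
  rw [← Finset.mul_sum, neg_mul, ← mul_neg, ← hre, dotProduct, Complex.re_sum]
  simp only [Complex.inner, Pi.star_apply, RCLike.star_def, mul_comm]

theorem IsMode.hasDerivAt_cross (h : IsMode a b c ξ u) (t : ℝ) :
    HasDerivAt (fun s => cross ξ (u s)) (c * ‖longitudinal ξ (u t)‖ ^ 2
      - c * ‖ξ‖ ^ 2 * ‖u t none‖ ^ 2 - (a + b) * ‖ξ‖ ^ 2 * cross ξ (u t)) t := by
  have hmul := (h.hasDerivAt_none t).star.mul (h.hasDerivAt_longitudinal t)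
  convert! Complex.imCLM.hasFDerivAt.comp_hasDerivAt t hmul using 1
  have hderiv : star (-(Complex.I * c * longitudinal ξ (u t))) * longitudinal ξ (u t)
      + star (u t none) * -((a + b) * ‖ξ‖ ^ 2 * longitudinal ξ (u t)
        + Complex.I * c * ‖ξ‖ ^ 2 * u t none)
      = (c * ‖longitudinal ξ (u t)‖ ^ 2 - c * ‖ξ‖ ^ 2 * ‖u t none‖ ^ 2 : ℝ) * Complex.I
        - ((a + b) * ‖ξ‖ ^ 2 : ℝ) * (conj (u t none) * longitudinal ξ (u t)) := by
    push_cast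
    simp only [← Complex.conj_mul', RCLike.star_def, map_neg, map_mul, Complex.conj_I,
      Complex.conj_ofReal]
    ring
  rw [Complex.imCLM_apply, hderiv]
  simp [cross, -Complex.ofReal_sub, -Complex.ofReal_mul, -Complex.ofReal_pow,
    -Complex.ofReal_add]

theorem exists_energy_decay (n : ℕ) (ha : 0 < a) (hab : 0 < a + b) (hc : 0 < c) :
    ∃ κ > 0, ∀ (ξ : E n) (u : ℝ → Option (Fin n) → ℂ), IsMode a b c ξ u → ∀ t, 0 ≤ t →
      energy (u t) ≤ 3 * Real.exp (-(κ * (‖ξ‖ ^ 2 / (1 + ‖ξ‖ ^ 2))) * t) * energy (u 0) := by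
  set d := min a (a + b)
  set D := 2 * c + (a + b) ^ 2 / c
  set ε := min (1 / 2) (d / D)
  have hD : 0 < D := by positivity
  have hε : 0 < ε := lt_min one_half_pos (div_pos (lt_min ha hab) hD)
  have hεd : ε * D ≤ d := (le_div_iff₀ hD).1 (min_le_right _ _)
  refine ⟨ε * c / 2, by positivity, fun ξ u h t ht => ?_⟩
  set w := ε / (1 + ‖ξ‖ ^ 2) with hw
  have hw0 : 0 ≤ w := by positivity
  have hwε : w ≤ ε := div_le_self hε.le (by linarith [sq_nonneg ‖ξ‖])
  have hwx : w * ‖ξ‖ ^ 2 ≤ ε := by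
    rw [hw, div_mul_eq_mul_div, div_le_iff₀ (by positivity)]
    linarith
  have hdiss (s : ℝ) : -2 * (a * ‖ξ‖ ^ 2 * kinetic (u s) + b * ‖longitudinal ξ (u s)‖ ^ 2)
      ≤ -2 * d * (‖ξ‖ ^ 2 * kinetic (u s)) := by
    have := norm_longitudinal_sq_le ξ (u s)
    nlinarith [min_le_left a (a + b), min_le_right a (a + b), sq_nonneg ‖longitudinal ξ (u s)‖,
      mul_nonneg (sq_nonneg ‖ξ‖) (kinetic_nonneg (u s)), le_total 0 b]
  have hL := le_exp_mul_of_deriv_le (κ := w * c * ‖ξ‖ ^ 2 / 2)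
    (fun s => (h.hasDerivAt_energy s).fun_add ((h.hasDerivAt_cross s).const_mul (2 * w)))
    (fun s => by
      rw [energy_eq_add_kinetic]
      exact (add_le_add_left (hdiss s) _).trans <| modified_energy_dissipation hc
        (min_le_left _ _) hεd hw0 hwε hwx (sq_nonneg _) (sq_nonneg _) (kinetic_nonneg _)
        (norm_longitudinal_sq_le ξ (u s)) (cross_sq_le ξ (u s))) ht
  have hcross (s : ℝ) : |2 * w * cross ξ (u s)| ≤ energy (u s) / 2 := by
    have := four_mul_abs_mul_le_add (sq_nonneg _) (kinetic_nonneg _) hw0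
      (hwε.trans (min_le_left _ _)) (hwx.trans (min_le_left _ _)) (cross_sq_le ξ (u s))
    rw [abs_mul, abs_of_nonneg (by positivity), energy_eq_add_kinetic]
    linarith
  have hrate : -(w * c * ‖ξ‖ ^ 2 / 2) * t = -(ε * c / 2 * (‖ξ‖ ^ 2 / (1 + ‖ξ‖ ^ 2))) * t := by
    rw [hw]; ring
  rw [hrate] at hL
  set e := Real.exp (-(ε * c / 2 * (‖ξ‖ ^ 2 / (1 + ‖ξ‖ ^ 2))) * t)
  have h0 : energy (u 0) + 2 * w * cross ξ (u 0) ≤ 3 / 2 * energy (u 0) := by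
    linarith [(abs_le.1 (hcross 0)).2]
  have := mul_le_mul_of_nonneg_right h0 (Real.exp_nonneg _ : 0 ≤ e)
  linarith [(abs_le.1 (hcross t)).1]

end EnergyDecay

section Longitudinal

variable {n : ℕ} {a b c : ℝ} {ξ : E n} {u : ℝ → Option (Fin n) → ℂ}

theorem IsMode.mul_longitudinal_sub_eq_exp_mul (h : IsMode a b c ξ u) {l : ℂ}
    (hl : l ^ 2 + (a + b) * ‖ξ‖ ^ 2 * l + c ^ 2 * ‖ξ‖ ^ 2 = 0) (t : ℝ) :
    l * longitudinal ξ (u t) - Complex.I * c * ‖ξ‖ ^ 2 * u t none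
      = Complex.exp (l * t)
        * (l * longitudinal ξ (u 0) - Complex.I * c * ‖ξ‖ ^ 2 * u 0 none) := by
  have hd (s : ℝ) : HasDerivAt (fun s : ℝ => Complex.exp (-l * s) *
      (l * longitudinal ξ (u s) - Complex.I * c * ‖ξ‖ ^ 2 * u s none)) 0 s := by
    have hexp : HasDerivAt (fun s : ℝ => Complex.exp (-l * s)) (Complex.exp (-l * s) * -l) s := by
      simpa using ((hasDerivAt_id (s : ℂ)).const_mul (-l)).cexp.comp_ofReal
    convert! hexp.mul (((h.hasDerivAt_longitudinal s).const_mul l).sub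
      ((h.hasDerivAt_none s).const_mul (Complex.I * c * ‖ξ‖ ^ 2))) using 1
    simp only [Pi.sub_apply]
    linear_combination (Complex.exp (-l * s) * longitudinal ξ (u s)) * hl
      - (Complex.exp (-l * s) * longitudinal ξ (u s) * c ^ 2 * ‖ξ‖ ^ 2) * Complex.I_sq
  have hconst := is_const_of_deriv_eq_zero (fun s => (hd s).differentiableAt)
    (fun s => (hd s).deriv) t 0
  rw [Complex.ofReal_zero, mul_zero, Complex.exp_zero, one_mul] at hconst
  rw [← hconst, ← mul_assoc, ← Complex.exp_add, neg_mul, add_neg_cancel, Complex.exp_zero, one_mul]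

/-- The two eigenvalues of the longitudinal part of the system are `-μ ± iθ`. -/
theorem IsMode.longitudinal_eq (h : IsMode a b c ξ u) {μ θ : ℝ} (hμ : 2 * μ = (a + b) * ‖ξ‖ ^ 2)
    (hθ : θ ^ 2 = c ^ 2 * ‖ξ‖ ^ 2 - μ ^ 2) (hθ0 : θ ≠ 0) (t : ℝ) :
    longitudinal ξ (u t) = Real.exp (-μ * t) *
      (longitudinal ξ (u 0) * (Real.cos (θ * t) - μ / θ * Real.sin (θ * t) : ℝ)
        - Complex.I * (c * ‖ξ‖ ^ 2 / θ * Real.sin (θ * t) : ℝ) * u 0 none) := by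
  have hμ' : (2 * μ : ℂ) = (a + b) * ‖ξ‖ ^ 2 := by exact_mod_cast hμ
  have hθ' : (θ : ℂ) ^ 2 = c ^ 2 * ‖ξ‖ ^ 2 - μ ^ 2 := by exact_mod_cast hθ
  have hθ0' : (θ : ℂ) ≠ 0 := by exact_mod_cast hθ0
  have hadd := h.mul_longitudinal_sub_eq_exp_mul (l := -μ + θ * Complex.I) (by
    linear_combination (θ : ℂ) ^ 2 * Complex.I_sq - hθ' - (-μ + θ * Complex.I) * hμ') t
  have hsub := h.mul_longitudinal_sub_eq_exp_mul (l := -μ + -θ * Complex.I) (by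
    linear_combination (θ : ℂ) ^ 2 * Complex.I_sq - hθ' - (-μ + -θ * Complex.I) * hμ') t
  rw [add_mul _ _ (t : ℂ), Complex.exp_add, mul_right_comm _ _ (t : ℂ), Complex.exp_mul_I] at hadd
  rw [add_mul _ _ (t : ℂ), Complex.exp_add, mul_right_comm _ _ (t : ℂ), Complex.exp_mul_I,
    neg_mul (θ : ℂ) (t : ℂ), Complex.cos_neg, Complex.sin_neg] at hsub
  refine mul_left_cancel₀ (mul_ne_zero (mul_ne_zero two_ne_zero hθ0') Complex.I_ne_zero) ?_
  push_cast
  linear_combination hadd - hsub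
    + 2 * Complex.I * Complex.exp (-μ * t) * longitudinal ξ (u 0) * Complex.sin (θ * t)
      * div_mul_cancel₀ (μ : ℂ) hθ0'
    + 2 * Complex.I ^ 2 * Complex.exp (-μ * t) * Complex.sin (θ * t) * u 0 none
      * div_mul_cancel₀ (c * ‖ξ‖ ^ 2 : ℂ) hθ0'

end Longitudinal

section Plancherel

variable {n : ℕ}

theorem norm_spec (f : L2Space n ℝ) : ‖spec f‖ = ‖f‖ := by
  rw [spec, Lp.norm_fourier_eq]
  refine (sq_eq_sq₀ (norm_nonneg _) (norm_nonneg _)).1 ?_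
  rw [← integral_norm_sq_eq, ← integral_norm_sq_eq]
  refine integral_congr_ae ?_
  filter_upwards [Complex.ofRealCLM.coeFn_compLp f] with x hx
  rw [hx, Complex.ofRealCLM_apply, Complex.norm_real]

theorem sum_norm_component_sq (w : L2Space n (E n)) : ∑ j, ‖component j w‖ ^ 2 = ‖w‖ ^ 2 := by
  simp only [← integral_norm_sq_eq]
  rw [← integral_finsetSum _ fun j _ => integrable_norm_sq (component j w)]
  refine integral_congr_ae ?_
  filter_upwards [eventually_all.2 fun j => coeFn_component j w] with x hx
  simp only [hx, EuclideanSpace.norm_sq_eq]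

variable (r : L2Space n ℝ) (w : L2Space n (E n))

theorem integrable_norm_specState_sq (i : Option (Fin n)) :
    Integrable fun ξ => ‖specState r w ξ i‖ ^ 2 :=
  integrable_norm_sq (spec (state r w i))

theorem integral_norm_specState_sq (i : Option (Fin n)) :
    ∫ ξ, ‖specState r w ξ i‖ ^ 2 = ‖state r w i‖ ^ 2 := by
  rw [← norm_spec, ← integral_norm_sq_eq]
  rfl

theorem integrable_kinetic_specState : Integrable fun ξ => kinetic (specState r w ξ) :=
  integrable_finsetSum _ fun j _ => integrable_norm_specState_sq r w (some j)

theorem integral_kinetic_specState : ∫ ξ, kinetic (specState r w ξ) = ‖w‖ ^ 2 := by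
  simp only [kinetic]
  rw [integral_finsetSum _ fun j _ => integrable_norm_specState_sq r w (some j),
    ← sum_norm_component_sq]
  exact Finset.sum_congr rfl fun j _ => integral_norm_specState_sq r w (some j)

theorem integrable_energy_specState : Integrable fun ξ => energy (specState r w ξ) :=
  integrable_finsetSum _ fun i _ => integrable_norm_specState_sq r w i

theorem integral_energy_specState : ∫ ξ, energy (specState r w ξ) = ‖r‖ ^ 2 + ‖w‖ ^ 2 := by
  simp only [energy_eq_add_kinetic]
  rw [integral_add (integrable_norm_specState_sq r w none) (integrable_kinetic_specState r w),
    integral_norm_specState_sq, integral_kinetic_specState, state]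

end Plancherel

section FourierIntegral

variable {n : ℕ}

theorem continuous_fourier_ofReal {f : E n → ℝ} (hf : Integrable f) :
    Continuous (𝓕 fun x => (f x : ℂ)) :=
  VectorFourier.fourierIntegral_continuous Real.continuous_fourierChar
    (innerSL ℝ).continuous₂ hf.ofReal

theorem norm_fourier_ofReal_le (f : E n → ℝ) (ξ : E n) :
    ‖𝓕 (fun x => (f x : ℂ)) ξ‖ ≤ ∫ x, |f x| := by
  refine (VectorFourier.norm_fourierIntegral_le_integral_norm _ _ _ _ _).trans_eq ?_
  simp only [Complex.norm_real, Real.norm_eq_abs]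

theorem fourier_ofReal_zero (f : E n → ℝ) :
    𝓕 (fun x => (f x : ℂ)) 0 = ((∫ x, f x : ℝ) : ℂ) := by
  simp [Real.fourier_eq, integral_complex_ofReal]

theorem spec_ae_eq_fourier {f : L2Space n ℝ} (hf : Integrable f) :
    spec f =ᵐ[volume] 𝓕 fun x => (f x : ℂ) := by
  refine ae_eq_of_integral_contDiff_smul_eq
    ((Lp.memLp _).locallyIntegrable (by norm_num))
    (continuous_fourier_ofReal hf).locallyIntegrable fun g hg hgs => ?_
  have hgc : HasCompactSupport fun ξ => (g ξ : ℂ) := hgs.comp_left Complex.ofReal_zero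
  set φ : 𝓢(E n, ℂ) := hgc.toSchwartzMap (Complex.ofRealCLM.contDiff.comp hg)
  have hswap : ∫ ξ, 𝓕 (fun x => (f x : ℂ)) ξ • φ ξ = ∫ x, (f x : ℂ) • 𝓕 (φ : E n → ℂ) x := by
    have := VectorFourier.integral_fourierIntegral_smul_eq_flip (L := innerₗ (E n))
      (μ := volume) (ν := volume) Real.continuous_fourierChar continuous_inner
      (hf.ofReal (𝕜 := ℂ)) φ.integrable
    rwa [flip_innerₗ] at this
  calc ∫ ξ, g ξ • spec f ξ = ∫ ξ, φ ξ * spec f ξ := rfl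
    _ = ∫ x, (f x : ℂ) • 𝓕 (φ : E n → ℂ) x := by
        rw [← pair_fourier, pair]
        simp only [fourier_coe, smul_eq_mul, mul_comm]
    _ = ∫ ξ, g ξ • 𝓕 (fun x => (f x : ℂ)) ξ := by
        rw [← hswap]
        simp only [smul_eq_mul, mul_comm _ (φ _)]
        rfl

variable {r : L2Space n ℝ} {w : L2Space n (E n)}

theorem specState_ae_eq_fourier (h : ∀ i, Integrable (state r w i)) :
    ∀ᵐ ξ, ∀ i, specState r w ξ i = 𝓕 (fun x => (state r w i x : ℂ)) ξ :=
  eventually_all.2 fun i => spec_ae_eq_fourier (h i)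

theorem ae_energy_specState_le (h : ∀ i, Integrable (state r w i)) :
    ∀ᵐ ξ, energy (specState r w ξ) ≤ (∑ i, ∫ x, |state r w i x|) ^ 2 := by
  filter_upwards [specState_ae_eq_fourier h] with ξ hξ
  calc energy (specState r w ξ) ≤ (∑ i, ‖specState r w ξ i‖) ^ 2 :=
        Finset.sum_sq_le_sq_sum_of_nonneg fun i _ => norm_nonneg _
    _ ≤ (∑ i, ∫ x, |state r w i x|) ^ 2 := by
        gcongr with i
        rw [hξ]
        exact norm_fourier_ofReal_le _ _

end FourierIntegral

section UpperBound

theorem sq_sqrt_mul_mul_rpow {D t : ℝ} (hD : 0 ≤ D) (ht : 0 ≤ t) (M p : ℝ) :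
    (√D * M * t ^ (p / 4)) ^ 2 = D * M ^ 2 * t ^ (p / 2) := by
  rw [mul_pow, mul_pow, Real.sq_sqrt hD, ← Real.rpow_natCast (t ^ _), ← Real.rpow_mul ht]
  congr 2
  push_cast
  ring

theorem exp_neg_le_rpow {p x : ℝ} (hp : 0 ≤ p) (hx : 0 < x) :
    Real.exp (-x) ≤ p ^ p * x ^ (-p) := by
  rcases hp.eq_or_lt with rfl | hp
  · simpa using hx.le
  · have hpow : (x / p) ^ p ≤ Real.exp x := by
      calc (x / p) ^ p ≤ Real.exp (x / p) ^ p := by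
            gcongr
            linarith [Real.add_one_le_exp (x / p)]
        _ = Real.exp x := by rw [← Real.exp_mul, div_mul_cancel₀ _ hp.ne']
    calc Real.exp (-x) = (Real.exp x)⁻¹ := Real.exp_neg x
      _ ≤ ((x / p) ^ p)⁻¹ := by gcongr
      _ = p ^ p * x ^ (-p) := by
          rw [Real.div_rpow hx.le hp.le, inv_div, Real.rpow_neg hx.le, div_eq_mul_inv]

theorem exp_neg_mul_div_one_add_le {s x : ℝ} (hs : 0 ≤ s) (hx : 0 ≤ x) :
    Real.exp (-(s * (x / (1 + x)))) ≤ Real.exp (-(s / 2) * x) + Real.exp (-(s / 2)) := by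
  rcases le_total x 1 with h | h
  · have hfrac : x / 2 ≤ x / (1 + x) := by gcongr; linarith
    refine le_add_of_le_of_nonneg (Real.exp_le_exp.2 ?_) (Real.exp_nonneg _)
    nlinarith
  · have hfrac : 1 / 2 ≤ x / (1 + x) := by
      rw [div_le_div_iff₀ two_pos (by positivity)]
      linarith
    refine le_add_of_nonneg_of_le (Real.exp_nonneg _) (Real.exp_le_exp.2 ?_)
    nlinarith

theorem integrable_exp_neg_mul_norm_sq {n : ℕ} {b : ℝ} (hb : 0 < b) :
    Integrable fun ξ : E n => Real.exp (-b * ‖ξ‖ ^ 2) := by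
  have := (GaussianFourier.integrable_cexp_neg_mul_sq_norm_add (b := b) (by simpa using hb) 0
    (0 : E n)).norm
  simpa [Complex.norm_exp, ← Complex.ofReal_pow] using this

variable {α β γ : ℝ}

theorem exists_norm_sq_velocity_le (n : ℕ) (hα : 0 < α) (hαβ : 0 < α + β) (hγ : 0 < γ) :
    ∃ κ > 0, ∀ (ρ₀ : L2Space n ℝ) (v₀ : L2Space n (E n)), (∀ i, Integrable (state ρ₀ v₀ i)) →
      ∀ (ρ : ℝ → L2Space n ℝ) (v : ℝ → L2Space n (E n)), IsSolution α β γ ρ₀ v₀ ρ v →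
      ∀ t > 0, ‖v t‖ ^ 2 ≤ 3 * ((π / (κ * t / 2)) ^ ((n : ℝ) / 2)
        * (∑ i, ∫ x, |state ρ₀ v₀ i x|) ^ 2
          + Real.exp (-(κ * t / 2)) * (‖ρ₀‖ ^ 2 + ‖v₀‖ ^ 2)) := by
  obtain ⟨κ, hκ, hdecay⟩ := exists_energy_decay (a := 4 * π ^ 2 * α) (b := 4 * π ^ 2 * β)
    (c := 2 * π * γ) n (by positivity) (by rw [← mul_add]; positivity) (by positivity)
  refine ⟨κ, hκ, fun ρ₀ v₀ hint ρ v h t ht => ?_⟩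
  set N := ∑ i, ∫ x, |state ρ₀ v₀ i x|
  set e₀ : E n → ℝ := fun ξ => energy (specState ρ₀ v₀ ξ)
  have hs : 0 < κ * t / 2 := by positivity
  have hgauss := (integrable_exp_neg_mul_norm_sq (n := n) hs).mul_const (N ^ 2)
  have he₀ := (integrable_energy_specState ρ₀ v₀).const_mul (Real.exp (-(κ * t / 2)))
  have hpoint : ∀ᵐ ξ, kinetic (specState (ρ t) (v t) ξ)
      ≤ 3 * (Real.exp (-(κ * t / 2) * ‖ξ‖ ^ 2) * N ^ 2 + Real.exp (-(κ * t / 2)) * e₀ ξ) := by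
    filter_upwards [h.specState_ae_eq_flow ht.le, ae_energy_specState_le hint] with ξ hflow hN
    have hd := hdecay ξ _ (isMode_flow _ _ _ ξ (specState ρ₀ v₀ ξ)) t ht.le
    rw [flow_zero, ← hflow] at hd
    have he : 0 ≤ e₀ ξ := Finset.sum_nonneg fun i _ => sq_nonneg _
    calc kinetic (specState (ρ t) (v t) ξ) ≤ energy (specState (ρ t) (v t) ξ) := by
          rw [energy_eq_add_kinetic]
          exact le_add_of_nonneg_left (sq_nonneg _)
      _ ≤ 3 * Real.exp (-(κ * (‖ξ‖ ^ 2 / (1 + ‖ξ‖ ^ 2))) * t) * e₀ ξ := hd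
      _ ≤ 3 * ((Real.exp (-(κ * t / 2) * ‖ξ‖ ^ 2) + Real.exp (-(κ * t / 2))) * e₀ ξ) := by
          rw [mul_assoc, neg_mul, mul_right_comm κ]
          gcongr
          exact exp_neg_mul_div_one_add_le (by positivity) (sq_nonneg _)
      _ ≤ _ := by
          rw [add_mul]
          gcongr
  calc ‖v t‖ ^ 2 = ∫ ξ, kinetic (specState (ρ t) (v t) ξ) := (integral_kinetic_specState _ _).symm
    _ ≤ ∫ ξ, 3 * (Real.exp (-(κ * t / 2) * ‖ξ‖ ^ 2) * N ^ 2 + Real.exp (-(κ * t / 2)) * e₀ ξ) :=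
        integral_mono_ae (integrable_kinetic_specState _ _) ((hgauss.add he₀).const_mul 3) hpoint
    _ = _ := by
        rw [integral_const_mul, integral_add hgauss he₀, integral_mul_const, integral_const_mul,
          GaussianFourier.integral_rexp_neg_mul_sq_norm hs, integral_energy_specState,
          finrank_euclideanSpace_fin]

theorem exists_norm_velocity_le (n : ℕ) (hα : 0 < α) (hαβ : 0 < α + β) (hγ : 0 < γ) :
    ∃ C > 0, ∀ (ρ₀ : L2Space n ℝ) (v₀ : L2Space n (E n)), (∀ i, Integrable (state ρ₀ v₀ i)) →
      ∀ (ρ : ℝ → L2Space n ℝ) (v : ℝ → L2Space n (E n)), IsSolution α β γ ρ₀ v₀ ρ v →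
      ∀ t > 0, ‖v t‖ ≤ C * ((∑ i, ∫ x, |state ρ₀ v₀ i x|) + ‖v₀‖ + ‖ρ₀‖)
        * t ^ (-(n : ℝ) / 4) := by
  obtain ⟨κ, hκ, hle⟩ := exists_norm_sq_velocity_le n hα hαβ hγ
  set p : ℝ := n / 2
  have hp : 0 ≤ p := by positivity
  set D : ℝ := 3 * (π ^ p + p ^ p) * (κ / 2) ^ (-p)
  have hD : 0 < D := by positivity
  refine ⟨√D, by positivity, fun ρ₀ v₀ hint ρ v h t ht => ?_⟩
  set N := ∑ i, ∫ x, |state ρ₀ v₀ i x|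
  have hN : 0 ≤ N := Finset.sum_nonneg fun i _ => integral_nonneg fun x => abs_nonneg _
  refine le_of_sq_le_sq ?_ (by positivity)
  calc ‖v t‖ ^ 2 ≤ 3 * ((π / (κ * t / 2)) ^ p * N ^ 2
        + Real.exp (-(κ * t / 2)) * (‖ρ₀‖ ^ 2 + ‖v₀‖ ^ 2)) := hle ρ₀ v₀ hint ρ v h t ht
    _ ≤ 3 * (π ^ p * (κ * t / 2) ^ (-p) * (N + ‖v₀‖ + ‖ρ₀‖) ^ 2
        + p ^ p * (κ * t / 2) ^ (-p) * (N + ‖v₀‖ + ‖ρ₀‖) ^ 2) := by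
        have hgauss : (π / (κ * t / 2)) ^ p = π ^ p * (κ * t / 2) ^ (-p) := by
          rw [Real.div_rpow (by positivity) (by positivity), Real.rpow_neg (by positivity),
            div_eq_mul_inv]
        rw [hgauss]
        gcongr
        · linarith [norm_nonneg v₀, norm_nonneg ρ₀]
        · exact exp_neg_le_rpow hp (by positivity)
        · nlinarith [norm_nonneg v₀, norm_nonneg ρ₀, mul_nonneg (norm_nonneg v₀) (norm_nonneg ρ₀)]
    _ = D * (N + ‖v₀‖ + ‖ρ₀‖) ^ 2 * t ^ (-(n : ℝ) / 2) := by
        rw [mul_div_right_comm, Real.mul_rpow (by positivity) ht.le, neg_div]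
        ring
    _ = (√D * (N + ‖v₀‖ + ‖ρ₀‖) * t ^ (-(n : ℝ) / 4)) ^ 2 :=
        (sq_sqrt_mul_mul_rpow hD.le ht.le _ _).symm

end UpperBound

section Oscillation

variable {n : ℕ}

theorem abs_im_longitudinal_le (ξ : E n) (u : Option (Fin n) → ℂ) :
    |(longitudinal ξ u).im| ≤ ‖ξ‖ * ∑ k, |(u (some k)).im| := by
  calc |(longitudinal ξ u).im| = |∑ k, ξ k * (u (some k)).im| := by
        simp only [longitudinal, Complex.im_sum, Complex.im_ofReal_mul]
    _ ≤ ∑ k, |ξ k * (u (some k)).im| := Finset.abs_sum_le_sum_abs _ _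
    _ ≤ ∑ k, ‖ξ‖ * |(u (some k)).im| := by
        gcongr with k
        rw [abs_mul]
        gcongr
        exact PiLp.norm_apply_le ξ k
    _ = ‖ξ‖ * ∑ k, |(u (some k)).im| := (Finset.mul_sum ..).symm

theorem norm_longitudinal_le (ξ : E n) (u : Option (Fin n) → ℂ) :
    ‖longitudinal ξ u‖ ≤ ‖ξ‖ * √(kinetic u) := by
  refine le_of_sq_le_sq ?_ (by positivity)
  rw [mul_pow, Real.sq_sqrt (kinetic_nonneg u)]
  exact norm_longitudinal_sq_le ξ u

theorem exists_sq_eq_sq_sub_sq {x μ : ℝ} (hx : 0 < x) (hμ0 : 0 ≤ μ) (hμ : μ ≤ x / 2) :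
    ∃ θ, 0 < θ ∧ θ ^ 2 = x ^ 2 - μ ^ 2 ∧ μ ≤ θ ∧ θ ≤ x ∧ x - θ ≤ μ ^ 2 / x := by
  have hθ : √(x ^ 2 - μ ^ 2) ^ 2 = x ^ 2 - μ ^ 2 := Real.sq_sqrt (by nlinarith)
  have hlow : x / 2 ≤ √(x ^ 2 - μ ^ 2) := Real.le_sqrt_of_sq_le (by nlinarith)
  have hup : √(x ^ 2 - μ ^ 2) ≤ x := Real.sqrt_le_iff.2 ⟨hx.le, by nlinarith⟩
  refine ⟨_, by linarith, hθ, by linarith, hup, ?_⟩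
  rw [le_div_iff₀ hx]
  nlinarith

/-- The terms with `p` and `x - Q` are errors: the main term is `c r² / θ * S * Q`. -/
theorem amplitude_ge {c r θ κ p x C S Q ε : ℝ} (hr : 0 < r) (hθ : 0 < θ) (hθc : θ ≤ c * r)
    (hκ0 : 0 ≤ κ) (hκ : κ ≤ 1) (hp : |p| ≤ r * ε) (hx : |x - Q| ≤ ε) (hC : |C| ≤ 1)
    (hS : |S| ≤ 1) :
    r * (|Q| * |S| - 3 * ε) ≤ |p * (C - κ * S) - c * r ^ 2 / θ * S * x| := by
  have hε : 0 ≤ ε := (abs_nonneg _).trans hx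
  have hvelocity : |p * (C - κ * S)| ≤ r * (2 * ε) := by
    have hκS : |κ * S| ≤ 1 := by
      rw [abs_mul, abs_of_nonneg hκ0]
      exact mul_le_one₀ hκ (abs_nonneg _) hS
    have hCS : |C - κ * S| ≤ 2 := (abs_sub _ _).trans (by linarith)
    calc |p * (C - κ * S)| = |p| * |C - κ * S| := abs_mul _ _
      _ ≤ r * ε * 2 := by gcongr
      _ = r * (2 * ε) := by ring
  have hdensity : r * (|Q| * |S| - ε) ≤ |c * r ^ 2 / θ * S * x| := by
    have hQx : |Q| - ε ≤ |x| := by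
      have := abs_sub_abs_le_abs_sub Q x
      rw [abs_sub_comm] at this
      linarith
    have hfactor : r ≤ c * r ^ 2 / θ := by
      rw [le_div_iff₀ hθ]
      nlinarith
    calc r * (|Q| * |S| - ε) ≤ r * (|S| * |x|) := by
          gcongr
          nlinarith [abs_nonneg S]
      _ ≤ c * r ^ 2 / θ * (|S| * |x|) := by gcongr
      _ = |c * r ^ 2 / θ * S * x| := by
          rw [abs_mul, abs_mul, abs_of_nonneg (hr.le.trans hfactor), mul_assoc]
  have := abs_sub_abs_le_abs_sub (c * r ^ 2 / θ * S * x) (p * (C - κ * S))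
  rw [abs_sub_comm] at this
  linarith

variable {a b c : ℝ} {ξ : E n} {u : ℝ → Option (Fin n) → ℂ} {t Q ε η : ℝ}

theorem IsMode.abs_im_longitudinal_ge (h : IsMode a b c ξ u) (hab : 0 ≤ a + b) (hc : 0 < c)
    (hξ : 0 < ‖ξ‖) (hsmall : (a + b) * ‖ξ‖ ≤ c) (ht : 0 ≤ t) (hQ : |(u 0 none).re - Q| ≤ ε)
    (hP : ∑ k, |(u 0 (some k)).im| ≤ ε) :
    Real.exp (-((a + b) * ‖ξ‖ ^ 2 / 2) * t) * (‖ξ‖ * (|Q| * (|Real.sin (c * t * ‖ξ‖)|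
        - (a + b) ^ 2 * ‖ξ‖ ^ 3 * t / (4 * c)) - 3 * ε)) ≤ |(longitudinal ξ (u t)).im| := by
  obtain ⟨μ, hμ⟩ : ∃ μ, μ = (a + b) * ‖ξ‖ ^ 2 / 2 := ⟨_, rfl⟩
  have hμ0 : 0 ≤ μ := by rw [hμ]; positivity
  obtain ⟨θ, hθ, hθsq, hμθ, hθc, hθd⟩ := exists_sq_eq_sq_sub_sq (x := c * ‖ξ‖) (by positivity)
    hμ0 (by rw [hμ]; nlinarith)
  have him : (longitudinal ξ (u t)).im = Real.exp (-μ * t) *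
      ((longitudinal ξ (u 0)).im * (Real.cos (θ * t) - μ / θ * Real.sin (θ * t))
        - c * ‖ξ‖ ^ 2 / θ * Real.sin (θ * t) * (u 0 none).re) := by
    rw [h.longitudinal_eq (μ := μ) (by rw [hμ]; ring) (by rw [hθsq, mul_pow]) hθ.ne' t,
      Complex.im_ofReal_mul, Complex.sub_im, Complex.im_mul_ofReal, mul_assoc Complex.I,
      Complex.I_mul_im, Complex.re_ofReal_mul]
  have hsin : |Real.sin (c * t * ‖ξ‖)| - (a + b) ^ 2 * ‖ξ‖ ^ 3 * t / (4 * c)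
      ≤ |Real.sin (θ * t)| := by
    have hphase : |c * t * ‖ξ‖ - θ * t| ≤ (a + b) ^ 2 * ‖ξ‖ ^ 3 * t / (4 * c) := by
      calc |c * t * ‖ξ‖ - θ * t| = (c * ‖ξ‖ - θ) * t := by
            rw [← abs_of_nonneg (mul_nonneg (sub_nonneg.2 hθc) ht)]
            congr 1
            ring
        _ ≤ μ ^ 2 / (c * ‖ξ‖) * t := by gcongr
        _ = (a + b) ^ 2 * ‖ξ‖ ^ 3 * t / (4 * c) := by
            rw [hμ]
            field_simp
            ring
    linarith [abs_sub_abs_le_abs_sub (Real.sin (c * t * ‖ξ‖)) (Real.sin (θ * t)),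
      Real.abs_sin_sub_sin_le (c * t * ‖ξ‖) (θ * t)]
  rw [him, ← hμ, abs_mul, abs_of_pos (Real.exp_pos _)]
  gcongr
  calc ‖ξ‖ * (|Q| * (|Real.sin (c * t * ‖ξ‖)| - _) - 3 * ε)
      ≤ ‖ξ‖ * (|Q| * |Real.sin (θ * t)| - 3 * ε) := by gcongr
    _ ≤ _ := amplitude_ge hξ hθ hθc (div_nonneg hμ0 hθ.le) ((div_le_one hθ).2 hμθ)
        ((abs_im_longitudinal_le ξ (u 0)).trans (by gcongr)) hQ (Real.abs_cos_le_one _)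
        (Real.abs_sin_le_one _)

theorem sq_mul_half_sub_le {y z A η k : ℝ} (hy : 0 ≤ y) (hyz : y ≤ z) (hA : 0 ≤ A)
    (hk : 0 ≤ k) (h : z * (A - η) ≤ √k) : y ^ 2 * (A ^ 2 / 2 - η ^ 2) ≤ k := by
  have hle : y * A ≤ √k + y * η := by
    rcases le_total A η with hAη | hAη
    · linarith [mul_le_mul_of_nonneg_left hAη hy, Real.sqrt_nonneg k]
    · linarith [mul_le_mul_of_nonneg_right hyz (sub_nonneg.2 hAη)]
  have hsq : (y * A) ^ 2 ≤ (√k + y * η) ^ 2 := pow_le_pow_left₀ (by positivity) hle 2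
  nlinarith [Real.sq_sqrt hk, sq_nonneg (√k - y * η)]

theorem IsMode.kinetic_ge (h : IsMode a b c ξ u) (hab : 0 ≤ a + b) (hc : 0 < c) (hξ : 0 < ‖ξ‖)
    (hsmall : (a + b) * ‖ξ‖ ≤ c) (ht : 0 ≤ t) (htξ : ‖ξ‖ ^ 2 * t ≤ 4)
    (hQ : |(u 0 none).re - Q| ≤ ε) (hP : ∑ k, |(u 0 (some k)).im| ≤ ε)
    (hη : |Q| * ((a + b) ^ 2 * ‖ξ‖ ^ 3 * t / (4 * c)) + 3 * ε ≤ η) :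
    Real.exp (-(4 * (a + b))) * (Q ^ 2 * Real.sin (c * t * ‖ξ‖) ^ 2 / 2 - η ^ 2) ≤
      kinetic (u t) := by
  have hamp : Real.exp (-((a + b) * ‖ξ‖ ^ 2 / 2) * t)
      * (|Q| * |Real.sin (c * t * ‖ξ‖)| - η) ≤ √(kinetic (u t)) := by
    refine le_of_mul_le_mul_left ?_ hξ
    calc ‖ξ‖ * (Real.exp (-((a + b) * ‖ξ‖ ^ 2 / 2) * t)
          * (|Q| * |Real.sin (c * t * ‖ξ‖)| - η))
        ≤ Real.exp (-((a + b) * ‖ξ‖ ^ 2 / 2) * t) * (‖ξ‖ * (|Q| * (|Real.sin (c * t * ‖ξ‖)|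
          - (a + b) ^ 2 * ‖ξ‖ ^ 3 * t / (4 * c)) - 3 * ε)) := by
          rw [mul_left_comm]
          refine mul_le_mul_of_nonneg_left (mul_le_mul_of_nonneg_left ?_ hξ.le) (Real.exp_nonneg _)
          linarith
      _ ≤ |(longitudinal ξ (u t)).im| := h.abs_im_longitudinal_ge hab hc hξ hsmall ht hQ hP
      _ ≤ ‖longitudinal ξ (u t)‖ := Complex.abs_im_le_norm _
      _ ≤ ‖ξ‖ * √(kinetic (u t)) := norm_longitudinal_le ξ (u t)
  have hexp : Real.exp (-(2 * (a + b))) ≤ Real.exp (-((a + b) * ‖ξ‖ ^ 2 / 2) * t) :=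
    Real.exp_le_exp.2 (by linarith [mul_le_mul_of_nonneg_left htξ hab])
  have hsq := sq_mul_half_sub_le (Real.exp_pos _).le hexp (by positivity)
    (kinetic_nonneg (u t)) hamp
  rw [mul_pow, sq_abs, sq_abs, ← Real.exp_nat_mul] at hsq
  convert! hsq using 3
  push_cast
  ring

end Oscillation

section Annulus

variable {n : ℕ} {k r Q η : ℝ}

/-- The annulus `r ≤ |ξ| ≤ 2 r` in `ℝⁿ`, on which the lower bound is read off with
`r = t ^ (-1 / 2)`. -/
def annulus (n : ℕ) (r : ℝ) : Set (E n) := {ξ | ‖ξ‖ ∈ Icc r (2 * r)}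

theorem measurableSet_annulus (n : ℕ) (r : ℝ) : MeasurableSet (annulus n r) :=
  measurableSet_Icc.preimage measurable_norm

theorem annulus_subset_closedBall (n : ℕ) (r : ℝ) :
    annulus n r ⊆ Metric.closedBall 0 (2 * r) :=
  fun _ hξ => mem_closedBall_zero_iff.2 hξ.2

theorem measure_annulus_ne_top (n : ℕ) (r : ℝ) : volume (annulus n r) ≠ ⊤ :=
  measure_ne_top_of_subset (annulus_subset_closedBall n r) measure_closedBall_lt_top.ne

theorem measureReal_annulus_le (n : ℕ) (hr : 0 ≤ r) : volume.real (annulus n r) ≤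
    (2 * r) ^ n * volume.real (Metric.ball (0 : E n) 1) := by
  calc volume.real (annulus n r) ≤ volume.real (Metric.closedBall (0 : E n) (2 * r)) :=
        measureReal_mono (annulus_subset_closedBall n r) measure_closedBall_lt_top.ne
    _ = _ := by
        rw [Measure.addHaar_real_closedBall _ _ (by positivity), finrank_euclideanSpace_fin]

theorem setIntegral_annulus_norm (hn : 1 ≤ n) (hr : 0 < r) (f : ℝ → ℝ) :
    ∫ ξ in annulus n r, f ‖ξ‖
      = n * volume.real (Metric.ball (0 : E n) 1) * ∫ y in Icc r (2 * r), y ^ (n - 1) * f y := by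
  have : Nonempty (Fin n) := ⟨⟨0, hn⟩⟩
  have hIcc : Ioi (0 : ℝ) ∩ Icc r (2 * r) = Icc r (2 * r) :=
    inter_eq_right.2 fun y hy => hr.trans_le hy.1
  calc ∫ ξ in annulus n r, f ‖ξ‖ = ∫ ξ : E n, (Icc r (2 * r)).indicator f ‖ξ‖ :=
        (integral_indicator (measurableSet_annulus n r)).symm
    _ = n * volume.real (Metric.ball (0 : E n) 1)
        * ∫ y in Ioi (0 : ℝ), (Icc r (2 * r)).indicator (fun y => y ^ (n - 1) * f y) y := by
        simp only [integral_fun_norm_addHaar, finrank_euclideanSpace_fin, nsmul_eq_mul, smul_eq_mul,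
          indicator_mul_right, mul_assoc]
    _ = _ := by rw [setIntegral_indicator measurableSet_Icc, hIcc]

theorem integral_sin_sq_ge (hr : 0 < r) (hkr : 2 ≤ k * r) :
    r / 4 ≤ ∫ y in Icc r (2 * r), Real.sin (k * y) ^ 2 := by
  have hk : 0 < k := pos_of_mul_pos_left (two_pos.trans_le hkr) hr.le
  have hderiv (y : ℝ) : HasDerivAt (fun y => y / 2 - Real.sin (2 * k * y) / (4 * k))
      (Real.sin (k * y) ^ 2) y := by
    have hsin : HasDerivAt (fun y => Real.sin (2 * k * y)) (Real.cos (2 * k * y) * (2 * k)) y := by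
      simpa using ((hasDerivAt_id y).const_mul (2 * k)).sin
    convert! ((hasDerivAt_id y).div_const 2).sub (hsin.div_const (4 * k)) using 1
    rw [mul_assoc 2 k y, Real.cos_two_mul, Real.cos_sq']
    field_simp
    ring
  have hboundary : (Real.sin (2 * k * (2 * r)) - Real.sin (2 * k * r)) / (4 * k) ≤ r / 4 := by
    rw [div_le_div_iff₀ (by positivity) (by norm_num)]
    nlinarith [Real.sin_le_one (2 * k * (2 * r)), Real.neg_one_le_sin (2 * k * r)]
  rw [integral_Icc_eq_integral_Ioc, ← intervalIntegral.integral_of_le (by linarith),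
    intervalIntegral.integral_eq_sub_of_hasDerivAt (fun y _ => hderiv y)
      ((by fun_prop : Continuous fun y => Real.sin (k * y) ^ 2).intervalIntegrable _ _)]
  rw [sub_div] at hboundary
  linarith

theorem setIntegral_sin_sq_norm_ge (hn : 1 ≤ n) (hr : 0 < r) (hkr : 2 ≤ k * r) :
    n * volume.real (Metric.ball (0 : E n) 1) * r ^ n / 4 ≤
      ∫ ξ in annulus n r, Real.sin (k * ‖ξ‖) ^ 2 := by
  rw [setIntegral_annulus_norm hn hr fun y => Real.sin (k * y) ^ 2, mul_div_assoc]
  gcongr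
  calc r ^ n / 4 = r ^ (n - 1) * (r / 4) := by
        rw [← mul_div_assoc, ← pow_succ, Nat.sub_add_cancel hn]
    _ ≤ r ^ (n - 1) * ∫ y in Icc r (2 * r), Real.sin (k * y) ^ 2 := by
        gcongr
        exact integral_sin_sq_ge hr hkr
    _ = ∫ y in Icc r (2 * r), r ^ (n - 1) * Real.sin (k * y) ^ 2 := (integral_const_mul ..).symm
    _ ≤ _ := by
        refine setIntegral_mono_on (Continuous.continuousOn (by fun_prop)).integrableOn_Icc
          (Continuous.continuousOn (by fun_prop)).integrableOn_Icc measurableSet_Icc fun y hy => ?_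
        gcongr
        exact hy.1

theorem integrableOn_annulus_of_continuous {f : E n → ℝ} (hf : Continuous f) :
    IntegrableOn f (annulus n r) :=
  (hf.continuousOn.integrableOn_compact (isCompact_closedBall 0 (2 * r))).mono_set
    (annulus_subset_closedBall n r)

theorem setIntegral_sin_sq_norm_sub_ge (hn : 1 ≤ n) (hr : 0 < r) (hkr : 2 ≤ k * r)
    (hη : η ^ 2 * 2 ^ n = Q ^ 2 * n / 16) :
    n * volume.real (Metric.ball (0 : E n) 1) / 16 * Q ^ 2 * r ^ n ≤
      ∫ ξ in annulus n r, (Q ^ 2 * Real.sin (k * ‖ξ‖) ^ 2 / 2 - η ^ 2) := by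
  have hsin : IntegrableOn (fun ξ => Q ^ 2 * Real.sin (k * ‖ξ‖) ^ 2 / 2) (annulus n r) :=
    integrableOn_annulus_of_continuous (by fun_prop)
  set V := volume.real (Metric.ball (0 : E n) 1)
  calc n * V / 16 * Q ^ 2 * r ^ n
      = Q ^ 2 * (n * V * r ^ n / 4) / 2 - (2 * r) ^ n * V * η ^ 2 := by
        rw [mul_pow]
        linear_combination (V * r ^ n) * hη
    _ ≤ Q ^ 2 * (∫ ξ in annulus n r, Real.sin (k * ‖ξ‖) ^ 2) / 2
        - volume.real (annulus n r) * η ^ 2 := by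
        gcongr
        · exact setIntegral_sin_sq_norm_ge hn hr hkr
        · exact measureReal_annulus_le n hr.le
    _ = _ := by
        rw [integral_sub hsin (integrableOn_const (measure_annulus_ne_top n r)), integral_div,
          integral_const_mul, setIntegral_const, smul_eq_mul]

theorem IsMode.kinetic_ge_of_mem_annulus {a b c t : ℝ} {ξ : E n} {u : ℝ → Option (Fin n) → ℂ}
    (h : IsMode a b c ξ u) (hab : 0 ≤ a + b) (hc : 0 < c) (hr : 0 < r) (hrt : r ^ 2 * t = 1)
    (hξ : ξ ∈ annulus n r) (hsmall : 2 * (a + b) * r ≤ c)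
    (hη : |Q| * (2 * (a + b) ^ 2 / c) * r ≤ η / 2) (hQ : |(u 0 none).re - Q| ≤ η / 6)
    (hP : ∑ k, |(u 0 (some k)).im| ≤ η / 6) :
    Real.exp (-(4 * (a + b))) * (Q ^ 2 * Real.sin (c * t * ‖ξ‖) ^ 2 / 2 - η ^ 2) ≤
      kinetic (u t) := by
  obtain ⟨hrξ, hξr⟩ : r ≤ ‖ξ‖ ∧ ‖ξ‖ ≤ 2 * r := hξ
  have ht : 0 < t := pos_of_mul_pos_right (hrt ▸ one_pos) (sq_nonneg r)
  have htξ : ‖ξ‖ ^ 2 * t ≤ 4 := by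
    calc ‖ξ‖ ^ 2 * t ≤ (2 * r) ^ 2 * t := by gcongr
      _ = 4 := by linear_combination 4 * hrt
  have hphase : (a + b) ^ 2 * ‖ξ‖ ^ 3 * t / (4 * c) ≤ 2 * (a + b) ^ 2 / c * r := by
    calc (a + b) ^ 2 * ‖ξ‖ ^ 3 * t / (4 * c)
        ≤ (a + b) ^ 2 * (2 * r) ^ 3 * t / (4 * c) := by gcongr
      _ = 2 * (a + b) ^ 2 / c * r := by
          field_simp
          linear_combination (4 * (a + b) ^ 2) * hrt
  refine h.kinetic_ge hab hc (hr.trans_le hrξ) ?_ ht.le htξ hQ hP ?_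
  · linarith [mul_le_mul_of_nonneg_left hξr hab]
  · linarith [mul_le_mul_of_nonneg_left hphase (abs_nonneg Q)]

end Annulus

section LowerBound

variable {n : ℕ}

theorem exists_specState_close {ρ₀ : L2Space n ℝ} {v₀ : L2Space n (E n)}
    (hint : ∀ i, Integrable (state ρ₀ v₀ i)) {ε : ℝ} (hε : 0 < ε) :
    ∃ δ > 0, ∀ᵐ ξ : E n, ‖ξ‖ < δ →
      |(specState ρ₀ v₀ ξ none).re - ∫ x, ρ₀ x| ≤ ε ∧
        ∑ k, |(specState ρ₀ v₀ ξ (some k)).im| ≤ ε := by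
  set F : Option (Fin n) → E n → ℂ := fun i => 𝓕 fun x => (state ρ₀ v₀ i x : ℂ)
  have hF (i : Option (Fin n)) : Continuous (F i) := continuous_fourier_ofReal (hint i)
  have hdensity : ∀ᶠ ξ in 𝓝 0, |(F none ξ).re - ∫ x, ρ₀ x| < ε := by
    refine ContinuousAt.eventually_lt (by fun_prop) continuousAt_const ?_
    simpa only [F, fourier_ofReal_zero, Complex.ofReal_re, state, sub_self, abs_zero] using hε
  have hvelocity : ∀ᶠ ξ in 𝓝 0, ∑ k, |(F (some k) ξ).im| < ε := by
    refine ContinuousAt.eventually_lt (by fun_prop) continuousAt_const ?_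
    simpa only [F, fourier_ofReal_zero, Complex.ofReal_im, abs_zero, Finset.sum_const_zero] using hε
  obtain ⟨δ, hδ, hball⟩ := Metric.eventually_nhds_iff.1 (hdensity.and hvelocity)
  refine ⟨δ, hδ, ?_⟩
  filter_upwards [specState_ae_eq_fourier hint] with ξ hξ hξδ
  obtain ⟨hre, him⟩ := hball (by rwa [dist_zero_right] : dist ξ 0 < δ)
  simp only [hξ]
  exact ⟨hre.le, him.le⟩

theorem eventually_mul_inv_sqrt_lt (k : ℝ) {d : ℝ} (hd : 0 < d) :
    ∀ᶠ t in atTop, k * (√t)⁻¹ < d := by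
  have hlim := (tendsto_inv_atTop_zero.comp Real.tendsto_sqrt_atTop).const_mul k
  rw [mul_zero] at hlim
  exact hlim.eventually_lt_const hd

theorem inv_sqrt_sq_mul {t : ℝ} (ht : 0 < t) : (√t)⁻¹ ^ 2 * t = 1 := by
  rw [inv_pow, Real.sq_sqrt ht.le, inv_mul_cancel₀ ht.ne']

theorem inv_sqrt_pow {t : ℝ} (ht : 0 ≤ t) (n : ℕ) : (√t)⁻¹ ^ n = t ^ (-(n : ℝ) / 2) := by
  rw [inv_pow, Real.sqrt_eq_rpow, ← Real.rpow_natCast, ← Real.rpow_mul ht, ← Real.rpow_neg ht]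
  congr 1
  ring

variable {α β γ : ℝ} {ρ₀ : L2Space n ℝ} {v₀ : L2Space n (E n)} {ρ : ℝ → L2Space n ℝ}
  {v : ℝ → L2Space n (E n)}

theorem IsSolution.eventually_kinetic_specState_ge (h : IsSolution α β γ ρ₀ v₀ ρ v)
    (hαβ : 0 ≤ α + β) (hγ : 0 < γ) (hint : ∀ i, Integrable (state ρ₀ v₀ i)) {η : ℝ} (hη : 0 < η) :
    ∀ᶠ t in atTop, ∀ᵐ ξ, ξ ∈ annulus n (√t)⁻¹ →
      Real.exp (-(16 * π ^ 2 * (α + β)))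
        * ((∫ x, ρ₀ x) ^ 2 * Real.sin (2 * π * γ * t * ‖ξ‖) ^ 2 / 2 - η ^ 2)
        ≤ kinetic (specState (ρ t) (v t) ξ) := by
  obtain ⟨δ, hδ, hclose⟩ := exists_specState_close hint (ε := η / 6) (by positivity)
  have hc : 0 < 2 * π * γ := by positivity
  have hab : 0 ≤ 4 * π ^ 2 * α + 4 * π ^ 2 * β := by rw [← mul_add]; positivity
  filter_upwards [eventually_gt_atTop 0, eventually_mul_inv_sqrt_lt 2 hδ,
    eventually_mul_inv_sqrt_lt (2 * (4 * π ^ 2 * α + 4 * π ^ 2 * β)) hc,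
    eventually_mul_inv_sqrt_lt
      (|∫ x, ρ₀ x| * (2 * (4 * π ^ 2 * α + 4 * π ^ 2 * β) ^ 2 / (2 * π * γ))) (half_pos hη)]
    with t ht hδt hsmall hphase
  have hr : 0 < (√t)⁻¹ := by positivity
  filter_upwards [hclose, h.specState_ae_eq_flow ht.le] with ξ hξ hflow hmem
  obtain ⟨hQ, hP⟩ := hξ (hmem.2.trans_lt hδt)
  have hge := (isMode_flow _ _ _ ξ (specState ρ₀ v₀ ξ)).kinetic_ge_of_mem_annulus hab hc hr
    (inv_sqrt_sq_mul ht) hmem hsmall.le hphase.le (by rwa [flow_zero]) (by rwa [flow_zero])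
  rw [hflow]
  convert! hge using 3
  ring

theorem exists_le_norm_velocity {n : ℕ} (hn : 1 ≤ n) (hαβ : 0 ≤ α + β) :
    ∃ C > 0, ∀ γ > 0, ∀ (ρ₀ : L2Space n ℝ) (v₀ : L2Space n (E n)),
      (∀ i, Integrable (state ρ₀ v₀ i)) → (∫ x, ρ₀ x) ≠ 0 →
      ∀ (ρ : ℝ → L2Space n ℝ) (v : ℝ → L2Space n (E n)), IsSolution α β γ ρ₀ v₀ ρ v →
      ∀ᶠ t in atTop, C * |∫ x, ρ₀ x| * t ^ (-(n : ℝ) / 4) ≤ ‖v t‖ := by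
  set q := Real.exp (-(16 * π ^ 2 * (α + β)))
  set V := volume.real (Metric.ball (0 : E n) 1)
  have hV : 0 < V :=
    ENNReal.toReal_pos (Metric.measure_ball_pos _ _ one_pos).ne' measure_ball_lt_top.ne
  have : (0 : ℝ) < n := by exact_mod_cast hn
  refine ⟨√(q * (n * V / 16)), by positivity, fun γ hγ ρ₀ v₀ hint hQ ρ v h => ?_⟩
  set Q := ∫ x, ρ₀ x
  set η := |Q| * √(n / (16 * 2 ^ n))
  have hη : 0 < η := by positivity
  have hη2 : η ^ 2 * 2 ^ n = Q ^ 2 * n / 16 := by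
    rw [mul_pow, sq_abs, Real.sq_sqrt (by positivity)]
    field_simp
  filter_upwards [eventually_gt_atTop 0,
    eventually_mul_inv_sqrt_lt 2 (d := 2 * π * γ) (by positivity),
    h.eventually_kinetic_specState_ge hαβ hγ hint hη] with t ht hcr hpoint
  set r := (√t)⁻¹
  have hr : 0 < r := by positivity
  have hkr : 2 ≤ 2 * π * γ * t * r := by
    have hrt : r ^ 2 * t = 1 := inv_sqrt_sq_mul ht
    nlinarith [mul_le_mul_of_nonneg_right hcr.le (by positivity : 0 ≤ r * t)]
  refine le_of_sq_le_sq ?_ (norm_nonneg _)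
  calc (√(q * (n * V / 16)) * |Q| * t ^ (-(n : ℝ) / 4)) ^ 2
      = q * (n * V / 16 * Q ^ 2 * r ^ n) := by
        rw [sq_sqrt_mul_mul_rpow (by positivity) ht.le, sq_abs, inv_sqrt_pow ht.le]
        ring
    _ ≤ q * ∫ ξ in annulus n r, (Q ^ 2 * Real.sin (2 * π * γ * t * ‖ξ‖) ^ 2 / 2 - η ^ 2) := by
        gcongr
        exact setIntegral_sin_sq_norm_sub_ge hn hr hkr hη2
    _ = ∫ ξ in annulus n r, q * (Q ^ 2 * Real.sin (2 * π * γ * t * ‖ξ‖) ^ 2 / 2 - η ^ 2) :=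
        (integral_const_mul ..).symm
    _ ≤ ∫ ξ in annulus n r, kinetic (specState (ρ t) (v t) ξ) :=
        setIntegral_mono_on_ae (integrableOn_annulus_of_continuous (by fun_prop))
          (integrable_kinetic_specState _ _).integrableOn (measurableSet_annulus n r) hpoint
    _ ≤ ∫ ξ, kinetic (specState (ρ t) (v t) ξ) :=
        setIntegral_le_integral (integrable_kinetic_specState _ _)
          (.of_forall fun ξ => kinetic_nonneg _)
    _ = ‖v t‖ ^ 2 := integral_kinetic_specState _ _

end LowerBound

section Data

variable {n : ℕ}

theorem integrable_state {r : L2Space n ℝ} {w : L2Space n (E n)} (hr : Integrable r)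
    (hw : ∀ j, Integrable fun x => w x j) (i : Option (Fin n)) : Integrable (state r w i) := by
  cases i with
  | none => exact hr
  | some j => exact (hw j).congr (coeFn_component j w).symm

theorem sum_integral_abs_state (r : L2Space n ℝ) (w : L2Space n (E n)) :
    ∑ i, ∫ x, |state r w i x| = (∫ x, |r x|) + ∑ j, ∫ x, |w x j| := by
  rw [Fintype.sum_option]
  congr 1
  refine Finset.sum_congr rfl fun j _ => integral_congr_ae ?_
  filter_upwards [coeFn_component j w] with x hx
  simp only [state, hx]

theorem MemL11.integral_abs_le_norm11 {f : E n → ℝ} (hf : MemL11 f) :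
    ∫ x, |f x| ≤ norm11 f :=
  integral_mono hf.1.abs hf.2 fun x =>
    le_mul_of_one_le_left (abs_nonneg _) (le_add_of_nonneg_right (norm_nonneg x))

theorem sum_integral_abs_add_le {f : E n → ℝ} {w : E n → E n} (hf : MemL11 f)
    (hw : ∀ j, MemL11 fun x => w x j) :
    (∑ j, ∫ x, |w x j|) + ∫ x, |f x|
      ≤ ‖moment w‖ + |∫ x, f x| + ∑ j, norm11 (fun x => w x j) + norm11 f := by
  have hsum := Finset.sum_le_sum fun j (_ : j ∈ Finset.univ) => (hw j).integral_abs_le_norm11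
  linarith [hf.integral_abs_le_norm11, norm_nonneg (moment w), abs_nonneg (∫ x, f x)]

theorem half_mul_add_le_mul {C p q : ℝ} (hC : 0 ≤ C) (hq : 0 < q) (h : p / q < 1 / (1 + 1)) :
    C / 2 * (p + q) ≤ C * q := by
  rw [div_lt_iff₀ hq] at h
  nlinarith

end Data

end LinearizedNS

end

theorem theorem1p3_general (n : ℕ) (hn : 1 ≤ n) (α β : ℝ) (hα : 0 < α) (hαβ : 0 < α + β) :
    ∃ C₁ : ℝ, 0 < C₁ ∧ ∀ γ : ℝ, 0 < γ → ∃ C₂ : ℝ, 0 < C₂ ∧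
      ∀ (ρ₀ : Lp ℝ 2 (volume : Measure (LinearizedNS.E n)))
        (v₀ : Lp (LinearizedNS.E n) 2 (volume : Measure (LinearizedNS.E n))),
        Integrable ρ₀ → (∀ j, Integrable fun x => v₀ x j) →
        ∀ (ρ : ℝ → Lp ℝ 2 (volume : Measure (LinearizedNS.E n)))
          (v : ℝ → Lp (LinearizedNS.E n) 2 (volume : Measure (LinearizedNS.E n))),
          LinearizedNS.IsSolution α β γ ρ₀ v₀ ρ v →
          (∀ t : ℝ, 0 < t →
            ‖v t‖ ≤ C₂ * ((∑ j, ∫ x, |v₀ x j|) + (∫ x, |ρ₀ x|) + ‖v₀‖ + ‖ρ₀‖)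
              * t ^ (-(n : ℝ) / 4)) ∧
          ((∫ x, ρ₀ x) ≠ 0 → ∃ T₁ : ℝ, 0 < T₁ ∧ ∀ t : ℝ, T₁ ≤ t →
            C₁ * |∫ x, ρ₀ x| * t ^ (-(n : ℝ) / 4) ≤ ‖v t‖) := by
  obtain ⟨C₁, hC₁, lower⟩ := LinearizedNS.exists_le_norm_velocity hn hαβ.le
  refine ⟨C₁, hC₁, fun γ hγ => ?_⟩
  obtain ⟨C₂, hC₂, upper⟩ := LinearizedNS.exists_norm_velocity_le n hα hαβ hγ
  refine ⟨C₂, hC₂, fun ρ₀ v₀ hρ₀ hv₀ ρ v h => ⟨fun t ht => ?_, fun hQ => ?_⟩⟩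
  · have hstate := upper ρ₀ v₀ (LinearizedNS.integrable_state hρ₀ hv₀) ρ v h t ht
    rwa [LinearizedNS.sum_integral_abs_state, add_comm (∫ x, |ρ₀ x|)] at hstate
  · exact (eventually_atTop.1 (lower γ hγ ρ₀ v₀ (LinearizedNS.integrable_state hρ₀ hv₀) hQ
      ρ v h)).imp' (max 1) fun T hT => ⟨by positivity, fun t ht => hT t (le_of_max_le_right ht)⟩

theorem theorem1p3 (n : ℕ) (hn : 2 ≤ n) (α β : ℝ) (hα : 0 < α) (hβ : 0 ≤ β) :
    ∃ C₁ : ℝ, 0 < C₁ ∧ ∃ K : ℝ, 0 < K ∧ ∀ γ : ℝ, 0 < γ →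
      ∃ C₂ : ℝ, 0 < C₂ ∧ ∃ T₂ : ℝ, 0 < T₂ ∧
        ∀ (ρ₀ : Lp ℝ 2 (volume : Measure (LinearizedNS.E n)))
          (v₀ : Lp (LinearizedNS.E n) 2 (volume : Measure (LinearizedNS.E n))),
          LinearizedNS.MemL11 ρ₀ → (∀ j, LinearizedNS.MemL11 (fun x => v₀ x j)) →
          ∀ (ρ : ℝ → Lp ℝ 2 (volume : Measure (LinearizedNS.E n)))
            (v : ℝ → Lp (LinearizedNS.E n) 2 (volume : Measure (LinearizedNS.E n))),
            LinearizedNS.IsSolution α β γ ρ₀ v₀ ρ v →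
            (∀ t : ℝ, T₂ ≤ t →
              ‖v t‖ ≤ C₂ * (‖LinearizedNS.moment v₀‖ + |∫ x, ρ₀ x|
                  + ∑ j, LinearizedNS.norm11 (fun x => v₀ x j) + LinearizedNS.norm11 ρ₀
                  + ‖v₀‖ + ‖ρ₀‖) * t ^ (-(n : ℝ) / 4)) ∧
            ((∫ x, ρ₀ x) ≠ 0 →
              ‖LinearizedNS.moment v₀‖ / |∫ x, ρ₀ x| < 1 / (1 + K) →
              ∃ T₁ : ℝ, 0 < T₁ ∧ ∀ t : ℝ, T₁ ≤ t →
                C₁ * (‖LinearizedNS.moment v₀‖ + |∫ x, ρ₀ x|) * t ^ (-(n : ℝ) / 4) ≤ ‖v t‖) := by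
  obtain ⟨C, hC, bounds⟩ := theorem1p3_general n (by lia) α β hα (by positivity)
  refine ⟨C / 2, half_pos hC, 1, one_pos, fun γ hγ => ?_⟩
  obtain ⟨C₂, hC₂, bounds⟩ := bounds γ hγ
  refine ⟨C₂, hC₂, 1, one_pos, fun ρ₀ v₀ hρ₀ hv₀ ρ v h => ?_⟩
  obtain ⟨upper, lower⟩ := bounds ρ₀ v₀ hρ₀.1 (fun j => (hv₀ j).1) ρ v h
  refine ⟨fun t ht => (upper t (one_pos.trans_le ht)).trans ?_, fun hQ hPQ =>
    (lower hQ).imp fun T₁ ⟨hT₁, hT⟩ => ⟨hT₁, fun t ht => le_trans ?_ (hT t ht)⟩⟩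
  · have _ : 0 < t := one_pos.trans_le ht
    gcongr _ * (?_ + _ + _) * _
    exact LinearizedNS.sum_integral_abs_add_le hρ₀ hv₀
  · have _ : 0 < t := hT₁.trans_le ht
    gcongr ?_ * _
    exact LinearizedNS.half_mul_add_le_mul hC.le (abs_pos.2 hQ) hPQ
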